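/- For $n\ge 2$ let $$\mathrm{EQ}'_n=\exists x_1\ldots\exists x_n\,\forall u_1\ldots\forall u_n\,\exists t_1\ldots\exists t_n\,\exists e_1\ldots\exists e_n.\ \bigwedge_{i=1}^n\big((x_i\lor u_i\lor\neg t_i)\land(\neg x_i\lor\neg u_i\lor\neg t_i)\big)\land(t_1\lor e_1)\land\bigwedge_{i=2}^{n-1}(\neg e_{i-1}\lor t_i\lor e_i)\land(\neg e_{n-1}\lor t_n).$$ A universal strategy consists of functions $f_u$, one for each universal variable $u$, where $f_u$ depends only on the variables left of $u$ in the prefix. It is winning if, for every assignment $\tau$ of the existential variables, the matrix is falsified by the assignment that extends $\tau$ by the values $f_u$ of the universal variables. A formula is false if it has a universal winning strategy. An $\mathrm{OBDD}(\land,\exists,\forall)$ refutation of a prenex CNF formula is a sequence of minimized OBDDs with one common variable order (an order of the variables of the formula) that starts with OBDDs for the clauses $C_1,\ldots,C_m$ of the matrix, in which every further line represents the conjunction of two earlier lines, or $\exists x.L$ for an earlier line $L$ and a variable $x$ of $L$, or $L[u/c]$ for an earlier line $L$, a constant $c\in\{0,1\}$ and a universal variable $u$ that is rightmost in the quantifier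 prefix among the variables of $L$, and whose last line represents $0$; its size is the total number of nodes of its OBDDs. IR-calc works on clauses of annotated literals $l^\sigma$, where $l$ is an existential literal and $\sigma$ is a partial assignment of universal variables; $[\sigma]$ denotes the restriction of $\sigma$ to the universal variables left of the variable of $l$. Its rules are: the axiom $\{l^{[\tau]} : l\in C \text{ existential}\}$ for a clause $C$ of the matrix, where $\tau$ is the minimal partial assignment falsifying all universal literals of $C$; resolution, from $C_1\lor e^\tau$ and $\neg e^\tau\lor C_2$ derive $C_1\lor C_2$; and instantiation, from $C$ derive $\{l^{[\sigma\circ\tau]} : l^\sigma\in C\}$ for a partial assignment $\tau$ of universal variables, where $\sigma\circ\tau$ extends $\sigma$ by the values of $\tau$ on variables not assigned by $\sigma$. A refutation derives the empty clause, and its size is its number of clauses. Then: 1. For every $n\ge2$, $\mathrm{EQ}'_n$ is false, the strategy $u_i=x_i$ $(1\le i\le n)$ is a universal winning strategy, and it is the only one as a function from assignments of the existential variables to assignments of the universal variables: in the play of any universal winning strategy against any assignment $\tau$ of the existential variables, $u_i$ receives the value $\tau(x_i)$ for all $i$. 2. The class $\{\mathrm{EQ}'_n\}_{n\ge2}$ has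 bounded pathwidth: there is a constant $k$ such that for all $n\ge 2$ the primal graph of the matrix (whose vertices are the variables occurring in the matrix, two of them being adjacent if they occur together in a clause) has pathwidth at most $k$. 3. There is a polynomial $p$ such that for every $n\ge2$ the formula $\mathrm{EQ}'_n$ has an $\mathrm{OBDD}(\land,\exists,\forall)$ refutation of size at most $p(n)$. 4. Every IR-calc refutation of $\mathrm{EQ}'_n$ has size $\Omega(2^n)$: there is a constant $c>0$ such that for all $n\ge2$ every IR-calc refutation of $\mathrm{EQ}'_n$ has size at least $c\,2^n$. 5. IR-calc does not $p$-simulate $\mathrm{OBDD}(\land,\exists,\forall)$: there is no polynomial $p$ such that, for every prenex CNF formula $\Phi$ and every $\mathrm{OBDD}(\land,\exists,\forall)$ refutation $P$ of $\Phi$, there is an IR-calc refutation of $\Phi$ of size at most $p(|P|)$, where $|P|$ is the size of $P$. -/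

import Mathlib

/-! ### Quantified Boolean formulas in prenex CNF -/

inductive Quantifier where
  | ex : Quantifier
  | all : Quantifier
  deriving DecidableEq

/-- A literal: `(v, true)` is the variable `v`, and `(v, false)` is its negation. -/
abbrev Lit (V : Type) : Type := V × Bool

abbrev Clause (V : Type) : Type := Finset (Lit V)

/-- A clause is satisfied by `a` if one of its literals is true under `a`. -/
def Clause.Sat {V : Type} (C : Clause V) (a : V → Bool) : Prop :=
  ∃ l ∈ C, a l.1 = l.2

/-- A PCNF formula: a quantifier prefix and a list of clauses over the quantified variables. -/
structure PCNF (V : Type) where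
  pre : List (Quantifier × V)
  matrix : List (Clause V)
  nodup : (pre.map Prod.snd).Nodup
  closed : ∀ C ∈ matrix, ∀ l ∈ C, l.1 ∈ pre.map Prod.snd

namespace PCNF

variable {V : Type}

/-- The variables of the formula, in the order of the quantifier prefix. -/
def vars (Φ : PCNF V) : List V := Φ.pre.map Prod.snd

def IsUniversal (Φ : PCNF V) (v : V) : Prop := (Quantifier.all, v) ∈ Φ.pre

def IsExistential (Φ : PCNF V) (v : V) : Prop := (Quantifier.ex, v) ∈ Φ.pre

/-- `v` is left of `w` in the quantifier prefix, i.e. `v ∈ D(w)`. -/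
def LeftOf [DecidableEq V] (Φ : PCNF V) (v w : V) : Prop :=
  v ∈ Φ.vars ∧ w ∈ Φ.vars ∧ Φ.vars.idxOf v < Φ.vars.idxOf w

/-- The assignment `a` falsifies the matrix. -/
def Falsifies (Φ : PCNF V) (a : V → Bool) : Prop := ∃ C ∈ Φ.matrix, ¬ C.Sat a

/-! ### Universal strategies

Assignments are taken to be total functions on the variable set `V`; only the values on the variables
of the formula matter. Likewise a strategy has a (meaningless) component `f v` for every `v : V`,
and only those of universal variables are used. -/

/-- `f` is a universal strategy: for universal `u`, `f u` depends only on the variables left of `u`. -/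
def IsUniversalStrategy [DecidableEq V] (Φ : PCNF V) (f : V → (V → Bool) → Bool) : Prop :=
  ∀ u, Φ.IsUniversal u → ∀ τ σ : V → Bool, (∀ v, Φ.LeftOf v u → τ v = σ v) → f u τ = f u σ

/-- The assignment `τ ∪ f(τ)`: the quantifier prefix is traversed from left to right, and each
universal variable is set according to the strategy. See `play_existential` and `play_universal`
for the equations that characterize it. -/
def play [DecidableEq V] (Φ : PCNF V) (f : V → (V → Bool) → Bool) (τ : V → Bool) : V → Bool :=
  Φ.pre.foldl
    (fun ρ qv => if qv.1 = Quantifier.all then Function.update ρ qv.2 (f qv.2 ρ) else ρ) τ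

theorem foldl_eq_of_not_all [DecidableEq V] (f : V → (V → Bool) → Bool) (v : V)
    (l : List (Quantifier × V)) (hl : (Quantifier.all, v) ∉ l) (ρ : V → Bool) :
    l.foldl (fun ρ qv => if qv.1 = Quantifier.all then Function.update ρ qv.2 (f qv.2 ρ) else ρ)
      ρ v = ρ v := by
  induction l generalizing ρ with
  | nil => rfl
  | cons p l ih =>
    rw [List.foldl_cons, ih (fun h => hl (List.mem_cons_of_mem _ h))]
    by_cases hp : p.1 = Quantifier.all
    · rw [if_pos hp, Function.update_of_ne]
      rintro rfl
      exact hl (by rw [← hp]; exact List.mem_cons_self)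
    · rw [if_neg hp]

theorem play_existential [DecidableEq V] (Φ : PCNF V) (f : V → (V → Bool) → Bool) (τ : V → Bool)
    (v : V) (hv : Φ.IsExistential v) : Φ.play f τ v = τ v := by
  refine foldl_eq_of_not_all f v _ (fun h => ?_) τ
  have := List.inj_on_of_nodup_map Φ.nodup h hv rfl
  simp at this

theorem play_universal [DecidableEq V] (Φ : PCNF V) (f : V → (V → Bool) → Bool)
    (hf : Φ.IsUniversalStrategy f) (τ : V → Bool) (u : V) (hu : Φ.IsUniversal u) :
    Φ.play f τ u = f u (Φ.play f τ) := by
  obtain ⟨l₁, l₂, h⟩ := List.append_of_mem hu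
  have hnd := Φ.nodup
  rw [h] at hnd
  simp only [List.map_append, List.map_cons, List.nodup_append, List.nodup_cons] at hnd
  obtain ⟨-, ⟨hu2, -⟩, hdis⟩ := hnd
  have hnot : ∀ v, v ∉ l₂.map Prod.snd → (Quantifier.all, v) ∉ l₂ :=
    fun v hv hm => hv (List.mem_map_of_mem (f := Prod.snd) hm)
  have hval : Φ.play f τ u = f u (l₁.foldl
      (fun ρ qv => if qv.1 = Quantifier.all then Function.update ρ qv.2 (f qv.2 ρ) else ρ) τ) := by
    unfold play
    rw [h, List.foldl_append, List.foldl_cons, foldl_eq_of_not_all f u l₂ (hnot u hu2)]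
    simp
  rw [hval]
  refine hf u hu _ _ (fun v hv => ?_)
  obtain ⟨-, -, hlt⟩ := hv
  have hv1 : v ∈ l₁.map Prod.snd := by
    by_contra hv1
    have hu1 : u ∉ l₁.map Prod.snd := fun hm => hdis u hm u List.mem_cons_self rfl
    unfold vars at hlt
    rw [h, List.map_append, List.idxOf_append_of_notMem hv1, List.idxOf_append_of_notMem hu1] at hlt
    simp at hlt
  unfold play
  rw [h, List.foldl_append, List.foldl_cons, foldl_eq_of_not_all f v l₂
    (hnot v (fun hm => hdis v hv1 v (List.mem_cons_of_mem _ hm) rfl))]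
  have hne : v ≠ u := fun e => hdis v hv1 u List.mem_cons_self e
  simp [hne]

/-- `f` is a universal winning strategy. -/
def IsUniversalWinning [DecidableEq V] (Φ : PCNF V) (f : V → (V → Bool) → Bool) : Prop :=
  Φ.IsUniversalStrategy f ∧ ∀ τ : V → Bool, Φ.Falsifies (Φ.play f τ)

/-- A formula is false if it has a universal winning strategy. -/
def IsFalse [DecidableEq V] (Φ : PCNF V) : Prop := ∃ f, Φ.IsUniversalWinning f

/-! ### Pathwidth -/

/-- The variable `v` occurs in the matrix. -/
def Occurs (Φ : PCNF V) (v : V) : Prop := ∃ C ∈ Φ.matrix, ∃ b, (v, b) ∈ C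

/-- The primal graph: its vertices are the variables that occur in the matrix, and two of them are
adjacent if they occur together in a clause. -/
def primalGraph (Φ : PCNF V) : SimpleGraph {v : V // Φ.Occurs v} where
  Adj v w := v ≠ w ∧ ∃ C ∈ Φ.matrix, (∃ b, (v.1, b) ∈ C) ∧ (∃ b, (w.1, b) ∈ C)
  symm := ⟨fun _ _ h => ⟨h.1.symm, h.2.imp fun _ hC => ⟨hC.1, hC.2.2, hC.2.1⟩⟩⟩
  loopless := ⟨fun _ h => h.1 rfl⟩

end PCNF

structure PathDecomposition {W : Type} (G : SimpleGraph W) where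
  len : ℕ
  bag : Fin len → Finset W
  vertex_mem : ∀ v, ∃ i, v ∈ bag i
  edge_mem : ∀ v w, G.Adj v w → ∃ i, v ∈ bag i ∧ w ∈ bag i
  interval : ∀ (v : W) (i k j : Fin len), i ≤ k → k ≤ j → v ∈ bag i → v ∈ bag j → v ∈ bag k

/-- The largest cardinality of a bag, minus one. -/
def PathDecomposition.width {W : Type} {G : SimpleGraph W} (D : PathDecomposition G) : ℕ :=
  (Finset.univ.sup fun i => (D.bag i).card) - 1

/-- The minimum width of a path decomposition (`⊤` if there is none, which cannot happen for a
finite graph). -/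
noncomputable def pathwidth {W : Type} (G : SimpleGraph W) : ℕ∞ :=
  ⨅ D : PathDecomposition G, (D.width : ℕ∞)

noncomputable def PCNF.pathwidth {V : Type} (Φ : PCNF V) : ℕ∞ := _root_.pathwidth Φ.primalGraph

/-! ### Ordered binary decision diagrams -/

/-- An OBDD with variable order `π`. `Node` is the set of non-sink nodes, and the two sinks are
`Sum.inr false` and `Sum.inr true`. For a constant function the root is a sink. Along each edge between
non-sink nodes the label strictly increases in the order, and each non-sink node can be reached from
the root. -/
structure OBDD {V : Type} [DecidableEq V] (π : List V) where
  Node : Type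
  fintype : Fintype Node
  label : Node → V
  child : Node → Bool → Node ⊕ Bool
  root : Node ⊕ Bool
  label_mem : ∀ v, label v ∈ π
  ordered : ∀ v b w, child v b = Sum.inl w → π.idxOf (label v) < π.idxOf (label w)
  reachable : ∀ v, Relation.ReflTransGen
    (fun p q : Node ⊕ Bool => ∃ w b, p = Sum.inl w ∧ q = child w b) root (Sum.inl v)

attribute [instance] OBDD.fintype

namespace OBDD

variable {V : Type} [DecidableEq V] {π : List V}

/-- The number of nodes, including the two sinks. -/
def size (B : OBDD π) : ℕ := Fintype.card B.Node + 2

/-- A bound on the length of the paths that start in a node. -/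
def rank (B : OBDD π) : B.Node ⊕ Bool → ℕ
  | Sum.inl v => π.length - π.idxOf (B.label v)
  | Sum.inr _ => 0

theorem rank_child_lt (B : OBDD π) (v : B.Node) (b : Bool) :
    B.rank (B.child v b) < B.rank (Sum.inl v) := by
  have hv := List.idxOf_lt_length_of_mem (B.label_mem v)
  rcases h : B.child v b with w | c
  · have := B.ordered v b w h
    simp only [rank]
    omega
  · simp only [rank]
    omega

/-- The label of the sink that is reached from a node under the assignment `a`. -/
def evalFrom (B : OBDD π) (a : V → Bool) : B.Node ⊕ Bool → Bool
  | Sum.inr c => c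
  | Sum.inl v => B.evalFrom a (B.child v (a (B.label v)))
  termination_by p => B.rank p
  decreasing_by exact B.rank_child_lt _ _

theorem evalFrom_inr (B : OBDD π) (a : V → Bool) (c : Bool) : B.evalFrom a (Sum.inr c) = c := by
  rw [evalFrom]

theorem evalFrom_inl (B : OBDD π) (a : V → Bool) (v : B.Node) :
    B.evalFrom a (Sum.inl v) = B.evalFrom a (B.child v (a (B.label v))) := by
  rw [evalFrom]

/-- The value `B(a)`. -/
def eval (B : OBDD π) (a : V → Bool) : Bool := B.evalFrom a B.root

/-- The variables that occur as labels in `B`. -/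
def vars (B : OBDD π) : Set V := Set.range B.label

/-- `B` is minimized: no OBDD with the same order that computes the same function is smaller. -/
def IsMinimized (B : OBDD π) : Prop :=
  ∀ B' : OBDD π, (∀ a, B'.eval a = B.eval a) → B.size ≤ B'.size

/-- `B` represents the conjunction of `B₁` and `B₂`. -/
def IsConj (B B₁ B₂ : OBDD π) : Prop := ∀ a, B.eval a = (B₁.eval a && B₂.eval a)

/-- `B` represents `∃ x. B₁` for a variable `x` that occurs in `B₁`. -/
def IsProjection (B B₁ : OBDD π) : Prop :=
  ∃ x ∈ B₁.vars, ∀ a, B.eval a =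
    (B₁.eval (Function.update a x false) || B₁.eval (Function.update a x true))

/-- `B` represents `B₁[u/c]` for a universal variable `u` that is rightmost, with respect to the
quantifier prefix, among the variables that occur in `B₁`. -/
def IsUniversalReduction (Φ : PCNF V) (B B₁ : OBDD π) : Prop :=
  ∃ u ∈ B₁.vars, Φ.IsUniversal u ∧ (∀ v ∈ B₁.vars, v ≠ u → Φ.LeftOf v u) ∧
    ∃ c : Bool, ∀ a, B.eval a = B₁.eval (Function.update a u c)

end OBDD

/-- An OBDD(∧, ∃, ∀)-refutation of `Φ`: a sequence of minimized OBDDs with a common order of the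
variables of `Φ` that starts with the clauses of the matrix, continues with applications of
conjunction, projection and universal reduction, and ends with an OBDD for the constant 0. -/
structure OBDDRefutation {V : Type} [DecidableEq V] (Φ : PCNF V) where
  order : List V
  order_nodup : order.Nodup
  mem_order : ∀ v, v ∈ order ↔ v ∈ Φ.vars
  last : ℕ
  line : Fin (last + 1) → OBDD order
  minimized : ∀ i, (line i).IsMinimized
  length_le : Φ.matrix.length ≤ last + 1
  input : ∀ (i : Fin (last + 1)) (h : i.1 < Φ.matrix.length),
    ∀ a, (line i).eval a = true ↔ (Φ.matrix[i.1]).Sat a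
  derived : ∀ i : Fin (last + 1), Φ.matrix.length ≤ i.1 →
    (∃ j k, j < i ∧ k < i ∧ (line i).IsConj (line j) (line k)) ∨
    (∃ j, j < i ∧ (line i).IsProjection (line j)) ∨
    (∃ j, j < i ∧ (line i).IsUniversalReduction Φ (line j))
  final : ∀ a, (line (Fin.last last)).eval a = false

/-- The sum of the sizes of the OBDDs. -/
def OBDDRefutation.size {V : Type} [DecidableEq V] {Φ : PCNF V} (P : OBDDRefutation Φ) : ℕ :=
  ∑ i, (P.line i).size

/-! ### IR-calc -/

/-- A partial assignment; `none` means that the variable is unassigned. -/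
abbrev PartialAssignment (V : Type) : Type := V → Option Bool

/-- `τ ∘ σ`: the extension of `τ` by the values of `σ` on the variables that `τ` leaves open. -/
def PartialAssignment.comp {V : Type} (τ σ : PartialAssignment V) : PartialAssignment V :=
  fun v => (τ v).orElse fun _ => σ v

/-- An annotated literal `l^σ` is the pair `(l, σ)`. -/
abbrev AnnLit (V : Type) : Type := Lit V × PartialAssignment V

abbrev AnnClause (V : Type) : Type := Set (AnnLit V)

namespace PCNF

variable {V : Type} [DecidableEq V]

open Classical in
/-- `[τ]` for a literal of the variable `x`: the restriction of `τ` to the universal variables that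
precede `x` in the quantifier prefix. -/
noncomputable def restrictAnn (Φ : PCNF V) (x : V) (τ : PartialAssignment V) :
    PartialAssignment V :=
  fun v => if Φ.IsUniversal v ∧ Φ.LeftOf v x then τ v else none

/-- `τ` is the minimal partial assignment of universal variables that falsifies each universal literal
of `C`. (There is none if `C` contains a universal variable together with its negation.) -/
def IsFalsifier (Φ : PCNF V) (C : Clause V) (τ : PartialAssignment V) : Prop :=
  ∀ v b, τ v = some b ↔ Φ.IsUniversal v ∧ (v, !b) ∈ C

/-- `D` is obtained by the axiom rule. -/
def IsIRAxiom (Φ : PCNF V) (D : AnnClause V) : Prop :=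
  ∃ C ∈ Φ.matrix, ∃ τ, Φ.IsFalsifier C τ ∧
    D = {p | p.1 ∈ C ∧ Φ.IsExistential p.1.1 ∧ p.2 = Φ.restrictAnn p.1.1 τ}

/-- `inst(τ, C)`. -/
noncomputable def inst (Φ : PCNF V) (τ : PartialAssignment V) (C : AnnClause V) : AnnClause V :=
  (fun p => (p.1, Φ.restrictAnn p.1.1 (p.2.comp τ))) '' C

end PCNF

/-- `D` is obtained from `D₁` and `D₂` by resolution on a pivot `e^τ`. -/
def IsIRResolvent {V : Type} (D D₁ D₂ : AnnClause V) : Prop :=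
  ∃ (e : V) (τ : PartialAssignment V) (C₁ C₂ : AnnClause V),
    D₁ = insert ((e, true), τ) C₁ ∧ D₂ = insert ((e, false), τ) C₂ ∧ D = C₁ ∪ C₂

/-- An IR-calc refutation of `Φ`: a sequence of annotated clauses, each obtained by the axiom rule,
or by resolution or instantiation from earlier ones, that ends with the empty clause. -/
structure IRRefutation {V : Type} [DecidableEq V] (Φ : PCNF V) where
  last : ℕ
  line : Fin (last + 1) → AnnClause V
  derived : ∀ i, Φ.IsIRAxiom (line i) ∨
    (∃ j k, j < i ∧ k < i ∧ IsIRResolvent (line i) (line j) (line k)) ∨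
    (∃ j, j < i ∧ ∃ τ : PartialAssignment V, (∀ v, τ v ≠ none → Φ.IsUniversal v) ∧
      line i = Φ.inst τ (line j))
  final : line (Fin.last last) = ∅

/-- The size of an IR-calc refutation is the number of its clauses. -/
def IRRefutation.size {V : Type} [DecidableEq V] {Φ : PCNF V} (R : IRRefutation Φ) : ℕ := R.last + 1

/-! ### The modified equality formulas -/

/-- The infinite set of variables `x_i`, `u_i`, `t_i`, `e_i`. -/
inductive Var where
  | x : ℕ → Var
  | u : ℕ → Var
  | t : ℕ → Var
  | e : ℕ → Var
  deriving DecidableEq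

/-- The formula `∃ x_1 … x_n ∀ u_1 … u_n ∃ t_1 … t_n ∃ e_1 … e_n` with matrix
`⋀ ((x_i ∨ u_i ∨ ¬t_i) ∧ (¬x_i ∨ ¬u_i ∨ ¬t_i)) ∧ (t_1 ∨ e_1) ∧ ⋀ (¬e_{i-1} ∨ t_i ∨ e_i) ∧
(¬e_{n-1} ∨ t_n)`, where the second big conjunction is over `2 ≤ i ≤ n - 1`. -/
def eqPrime (n : ℕ) (hn : 2 ≤ n) : PCNF Var where
  pre :=
    (List.range' 1 n).map (fun i => (Quantifier.ex, Var.x i)) ++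
    (List.range' 1 n).map (fun i => (Quantifier.all, Var.u i)) ++
    (List.range' 1 n).map (fun i => (Quantifier.ex, Var.t i)) ++
    (List.range' 1 n).map (fun i => (Quantifier.ex, Var.e i))
  matrix :=
    (List.range' 1 n).flatMap (fun i =>
      [{(Var.x i, true), (Var.u i, true), (Var.t i, false)},
       {(Var.x i, false), (Var.u i, false), (Var.t i, false)}]) ++
    [{(Var.t 1, true), (Var.e 1, true)}] ++
    (List.range' 2 (n - 2)).map (fun i =>
      {(Var.e (i - 1), false), (Var.t i, true), (Var.e i, true)}) ++
    [{(Var.e (n - 1), false), (Var.t n, true)}]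
  nodup := by
    simp [List.nodup_append, Function.comp_def, List.nodup_range', List.nodup_map_iff_inj_on]
    grind
  closed := by
    intro C hC l hl
    simp only [List.mem_append, List.mem_flatMap, List.mem_map, List.mem_cons, List.not_mem_nil,
      or_false, List.mem_range'_1] at hC
    rcases hC with ((⟨i, hi, rfl | rfl⟩ | rfl) | ⟨i, hi, rfl⟩) | rfl <;>
    · simp only [Finset.mem_insert, Finset.mem_singleton] at hl
      rcases hl with rfl | rfl | rfl <;> simp <;> omega

/-- The strategy `u_i = x_i`. -/
def eqStrategy : Var → (Var → Bool) → Bool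
  | Var.u i, a => a (Var.x i)
  | _, _ => false

/-! With `e 0` read as true and `e n` as false, the clauses in `t` and `e` alone form a chain of
links `e (i-1) → t i ∨ e i`, which is satisfiable exactly when some `t i` is true; and `t i` forces
`x i ≠ u i`. Projecting out `t` and `e` therefore leaves the statement that `x i ≠ u i` for some `i`
(`exists_of_forall_blockSat`, `matrix_sat_chainWitness`). So copying `x` wins for the universal
player, and any deviation is punished by the existential player, who sets `t` and `e` last.

Upper bound: the constraints are local, each living in a bag of five variables, which also bounds
the pathwidth. In an order with contiguous blocks, any set of clauses with any variables projected
out has boundedly many subfunctions at each cut (`narrowOn_projectedConj`). The nodes of the reduced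
OBDD are the nonconstant subfunctions, so all these functions have small minimized OBDDs. The
refutation conjoins all clauses, projects out `t` and `e`, and then removes the pairs `(x i, u i)`
from the last to the first: setting `u i` to 0 and to 1 gives two lines whose conjunction no longer
mentions the pair (`exists_isDerivation_differsBelow`).

Lower bound: fix values `α` of the `x i`. Axioms are `Productive` for `α`, instantiation preserves
this, and the empty clause is not productive. The first unproductive line is thus a resolvent, and
by `Productive.resolve` the annotation of its pivot sets every `u i` to `α i`. One line has one
pivot, so the `2 ^ n` choices of `α` need distinct lines. The two bounds together refute a
p-simulation. -/

/-! ### Restrictions of Boolean functions -/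

section BooleanFunctions

variable {V : Type} [DecidableEq V]

/-- The value of `g` depends on the variable `v`. -/
def Essential (g : (V → Bool) → Bool) (v : V) : Prop :=
  ∃ a, g (Function.update a v false) ≠ g (Function.update a v true)

def IsConstant (g : (V → Bool) → Bool) : Prop := ∀ a b, g a = g b

/-- `g` depends only on the variables in `π`. -/
def SupportedOn (π : List V) (g : (V → Bool) → Bool) : Prop :=
  ∀ a b : V → Bool, (∀ v ∈ π, a v = b v) → g a = g b

theorem update_eq_of_not_essential {g : (V → Bool) → Bool} {v : V} (h : ¬ Essential g v)
    (a : V → Bool) (b : Bool) : g (Function.update a v b) = g a := by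
  have key : ∀ c d, g (Function.update a v c) = g (Function.update a v d) := by
    have := not_exists.1 h a
    push Not at this
    rintro (_ | _) (_ | _) <;> simp [this]
  rw [key b (a v), Function.update_eq_self]

/-- Turn `a` into `b` by changing one variable of `l` at a time; the value of `g` must change at
some step, and that step changes an essential variable. -/
theorem exists_essential_of_ne {g : (V → Bool) → Bool} (l : List V) {a b : V → Bool}
    (hab : ∀ v, v ∉ l → a v = b v) (hne : g a ≠ g b) : ∃ v ∈ l, a v ≠ b v ∧ Essential g v := by
  induction l generalizing a with
  | nil => exact absurd (congrArg g (funext fun v => hab v (by simp))) hne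
  | cons w l ih =>
    by_cases hw : a w ≠ b w ∧ Essential g w
    · exact ⟨w, by simp, hw⟩
    have h1 : g (Function.update a w (b w)) = g a := by
      by_cases hE : Essential g w
      · have : a w = b w := by
          by_contra hc
          exact hw ⟨hc, hE⟩
        rw [← this, Function.update_eq_self]
      · exact update_eq_of_not_essential hE _ _
    obtain ⟨v, hv, hv1, hv2⟩ := @ih (Function.update a w (b w)) (fun v hv => by
      by_cases hvw : v = w
      · subst hvw; simp
      · rw [Function.update_of_ne hvw]
        exact hab v (by simp [hvw, hv])) (by rwa [h1])
    refine ⟨v, by simp [hv], ?_, hv2⟩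
    by_cases hvw : v = w
    · subst hvw; simp at hv1
    · rwa [Function.update_of_ne hvw] at hv1

theorem SupportedOn.mem_of_essential {π : List V} {g : (V → Bool) → Bool} (hg : SupportedOn π g)
    {v : V} (hv : Essential g v) : v ∈ π := by
  by_contra hc
  obtain ⟨a, ha⟩ := hv
  refine ha (hg _ _ fun w hw => ?_)
  have : w ≠ v := fun h => hc (h ▸ hw)
  simp [this]

/-- The assignment that agrees with `a` on the first `k` variables of `π` and with `z` elsewhere. -/
def mix (π : List V) (k : ℕ) (a z : V → Bool) : V → Bool :=
  fun v => if π.idxOf v < k then a v else z v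

/-- The subfunction of `f` in which the first `k` variables of `π` are fixed according to `a`. -/
def subfunction (π : List V) (f : (V → Bool) → Bool) (k : ℕ) (a : V → Bool) : (V → Bool) → Bool :=
  fun z => f (mix π k a z)

theorem supportedOn_subfunction {π : List V} {f : (V → Bool) → Bool} (hf : SupportedOn π f) (k : ℕ)
    (a : V → Bool) : SupportedOn π (subfunction π f k a) := by
  intro y z h
  refine hf _ _ fun v hv => ?_
  simp only [mix, h v hv]

theorem le_idxOf_of_essential_subfunction {π : List V} {f : (V → Bool) → Bool} {k : ℕ}
    {a : V → Bool} {v : V} (hv : Essential (subfunction π f k a) v) : k ≤ π.idxOf v := by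
  by_contra! hc
  obtain ⟨z, hz⟩ := hv
  refine hz (congrArg f (funext fun w => ?_))
  by_cases hw : w = v
  · subst hw; simp [mix, hc]
  · simp [mix, hw]

theorem SupportedOn.exists_first_essential {π : List V} {g : (V → Bool) → Bool}
    (hg : SupportedOn π g) (hc : ¬ IsConstant g) :
    ∃ v, Essential g v ∧ ∀ w, Essential g w → π.idxOf v ≤ π.idxOf w := by
  have hex : ∃ v, Essential g v := by
    simp only [IsConstant, not_forall] at hc
    obtain ⟨a, b, hab⟩ := hc
    have hb : g b = g (fun v => if v ∈ π then b v else a v) := hg _ _ fun v hv => by simp [hv]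
    rw [hb] at hab
    obtain ⟨v, -, -, hv⟩ := exists_essential_of_ne π (fun v hv => by simp [hv]) hab
    exact ⟨v, hv⟩
  obtain ⟨v, hv, hmin⟩ := WellFounded.has_min (measure fun v => π.idxOf v).wf {v | Essential g v} hex
  exact ⟨v, hv, fun w hw => not_lt.1 (hmin w hw)⟩

/-- All variables between the cut and `v` are inessential, so they may as well be fixed according to
`a`. This makes the set of subfunctions closed under taking children in the reduced OBDD. -/
theorem update_subfunction {π : List V} {f : (V → Bool) → Bool} (hf : SupportedOn π f) {k : ℕ}
    {a : V → Bool} {v : V} (hv : Essential (subfunction π f k a) v)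
    (hmin : ∀ w, Essential (subfunction π f k a) w → π.idxOf v ≤ π.idxOf w) (b : Bool) :
    (fun z => subfunction π f k a (Function.update z v b)) =
      subfunction π f (π.idxOf v + 1) (Function.update a v b) := by
  have hk := le_idxOf_of_essential_subfunction hv
  have hmem : v ∈ π := (supportedOn_subfunction hf k a).mem_of_essential hv
  have hinj : ∀ w, π.idxOf w = π.idxOf v → w = v := fun w hw => ((List.idxOf_inj hmem).1 hw.symm).symm
  funext z
  -- `y` differs from `Function.update z v b` only at variables before `v`, where by `hmin` the
  -- subfunction has no essential variable.
  set y := mix π (π.idxOf v + 1) (Function.update a v b) z with hy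
  have h1 : subfunction π f (π.idxOf v + 1) (Function.update a v b) z = subfunction π f k a y := by
    refine congrArg f (funext fun w => ?_)
    change y w = mix π k a y w
    simp only [mix]
    split_ifs with hw
    · have hwv : w ≠ v := by rintro rfl; omega
      simp [hy, mix, hwv, show π.idxOf w < π.idxOf v + 1 by omega]
    · rfl
  rw [h1]
  by_contra hne
  obtain ⟨w, -, hw, hE⟩ := exists_essential_of_ne π (fun w hw => by
    have h2 : π.idxOf w = π.length := List.idxOf_eq_length_iff.2 hw
    have h3 := List.idxOf_lt_length_of_mem hmem
    have hwv : w ≠ v := by rintro rfl; exact hw hmem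
    simp [hy, mix, hwv, show ¬ π.idxOf w < π.idxOf v + 1 by omega]) hne
  have hle := hmin w hE
  by_cases hwv : w = v
  · subst hwv; simp [hy, mix] at hw
  · have : π.idxOf w ≠ π.idxOf v := fun h => hwv (hinj w h)
    simp [hy, mix, hwv, show ¬ π.idxOf w < π.idxOf v + 1 by omega] at hw

theorem subfunction_zero (π : List V) (f : (V → Bool) → Bool) (a : V → Bool) :
    subfunction π f 0 a = f := by
  funext z
  exact congrArg f (funext fun v => by simp [mix])

/-- Moving the cut by one variable either changes nothing or follows an edge of the reduced OBDD;
reachability of all nodes follows by induction. -/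
theorem subfunction_succ {π : List V} {f : (V → Bool) → Bool} (hf : SupportedOn π f)
    (hπ : π.Nodup) (k : ℕ) (a : V → Bool) :
    subfunction π f (k + 1) a = subfunction π f k a ∨
    ∃ v, Essential (subfunction π f k a) v ∧ π.idxOf v = k ∧ subfunction π f (k + 1) a =
      fun z => subfunction π f k a (Function.update z v (a v)) := by
  by_cases hk : k < π.length
  · have hidx : π.idxOf π[k] = k := hπ.idxOf_getElem k hk
    have hinj : ∀ w, π.idxOf w = k → w = π[k] := fun w hw =>
      ((List.idxOf_inj (List.getElem_mem hk)).1 (hidx.trans hw.symm)).symm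
    have heq : subfunction π f (k + 1) a =
        fun z => subfunction π f k a (Function.update z π[k] (a π[k])) := by
      funext z
      refine congrArg f (funext fun w => ?_)
      by_cases hw : w = π[k]
      · simp [mix, hw, hidx]
      · have : π.idxOf w ≠ k := fun h => hw (hinj w h)
        simp [mix, hw, show π.idxOf w < k + 1 ↔ π.idxOf w < k by omega]
    by_cases hE : Essential (subfunction π f k a) π[k]
    · exact Or.inr ⟨_, hE, hidx, heq⟩
    · left
      rw [heq]
      funext z
      exact update_eq_of_not_essential hE _ _
  · left
    funext z
    refine hf _ _ fun v hv => ?_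
    have := List.idxOf_lt_length_of_mem hv
    simp [mix, show π.idxOf v < k + 1 by omega, show π.idxOf v < k by omega]

end BooleanFunctions

/-! ### The reduced OBDD of a Boolean function -/

namespace OBDD

variable {V : Type} [DecidableEq V] {π : List V}

theorem evalFrom_congr (B : OBDD π) (k : ℕ) (a b : V → Bool)
    (hab : ∀ v, k ≤ π.idxOf v → a v = b v) (p : B.Node ⊕ Bool)
    (hp : ∀ v, p = Sum.inl v → k ≤ π.idxOf (B.label v)) : B.evalFrom a p = B.evalFrom b p := by
  induction hn : B.rank p using Nat.strong_induction_on generalizing p with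
  | _ n ih =>
    subst hn
    rcases p with v | c
    · have hv := hp v rfl
      rw [evalFrom_inl, evalFrom_inl, hab _ hv]
      exact ih _ (B.rank_child_lt v _) _ (fun w hw => hv.trans (B.ordered _ _ _ hw).le) rfl
    · rw [evalFrom_inr, evalFrom_inr]

/-- Follow the path given by `a` until it leaves the first `k` variables. Thus every subfunction is
computed at a node of any OBDD for the function. -/
theorem exists_evalFrom_mix (B : OBDD π) (k : ℕ) (a : V → Bool) (p : B.Node ⊕ Bool) :
    ∃ q, ∀ z, B.evalFrom (mix π k a z) p = B.evalFrom z q := by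
  induction hn : B.rank p using Nat.strong_induction_on generalizing p with
  | _ n ih =>
    subst hn
    rcases p with v | c
    · by_cases hv : π.idxOf (B.label v) < k
      · obtain ⟨q, hq⟩ := ih _ (B.rank_child_lt v (a (B.label v))) _ rfl
        refine ⟨q, fun z => ?_⟩
        rw [evalFrom_inl, ← hq]
        simp [mix, hv]
      · refine ⟨Sum.inl v, fun z => B.evalFrom_congr k _ _ (fun w hw => ?_) _ ?_⟩
        · simp [mix, hw]
        · rintro w hw
          cases hw
          omega
    · exact ⟨Sum.inr c, fun z => by rw [evalFrom_inr, evalFrom_inr]⟩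

/-- The nodes of the reduced OBDD: the subfunctions that are not constant. -/
abbrev ReducedNode (π : List V) (f : (V → Bool) → Bool) : Type :=
  {g : (V → Bool) → Bool // (∃ k a, g = subfunction π f k a) ∧ ¬ IsConstant g}

theorem finite_range_subfunction {f : (V → Bool) → Bool} (hf : SupportedOn π f) (k : ℕ) :
    (Set.range (subfunction π f k)).Finite := by
  classical
  refine (Set.finite_range fun c : {v // v ∈ π} → Bool =>
    subfunction π f k fun v => if h : v ∈ π then c ⟨v, h⟩ else false).subset ?_
  rintro _ ⟨a, rfl⟩
  refine ⟨fun v => a v, ?_⟩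
  funext z
  refine hf _ _ fun v hv => ?_
  simp [mix, hv]

theorem isConstant_subfunction {f : (V → Bool) → Bool} (hf : SupportedOn π f) {k : ℕ} (hk : π.length ≤ k) (a : V → Bool) :
    IsConstant (subfunction π f k a) := by
  intro y z
  refine hf _ _ fun v hv => ?_
  have := List.idxOf_lt_length_of_mem hv
  simp [mix, show π.idxOf v < k by omega]

theorem reducedNode_subset {f : (V → Bool) → Bool} (hf : SupportedOn π f) :
    {g | (∃ k a, g = subfunction π f k a) ∧ ¬ IsConstant g} ⊆
      ⋃ k : Fin π.length, Set.range (subfunction π f k) := by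
  rintro g ⟨⟨k, a, rfl⟩, hc⟩
  have hk : k < π.length := by
    by_contra! hk
    exact hc (isConstant_subfunction hf hk a)
  exact Set.mem_iUnion.2 ⟨⟨k, hk⟩, a, rfl⟩

theorem finite_reducedNode {f : (V → Bool) → Bool} (hf : SupportedOn π f) : Finite (ReducedNode π f) :=
  Set.Finite.subset (Set.finite_iUnion fun k : Fin π.length => finite_range_subfunction hf k)
    (reducedNode_subset hf)

namespace ReducedNode

variable {f : (V → Bool) → Bool}

theorem supportedOn (hf : SupportedOn π f) (g : ReducedNode π f) : SupportedOn π g.1 := by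
  obtain ⟨_, ⟨k, a, rfl⟩, _⟩ := g
  exact supportedOn_subfunction hf k a

/-- The first variable on which `g` depends. -/
noncomputable def label (hf : SupportedOn π f) (g : ReducedNode π f) : V :=
  ((g.supportedOn hf).exists_first_essential g.2.2).choose

theorem essential_label (hf : SupportedOn π f) (g : ReducedNode π f) :
    Essential g.1 (g.label hf) :=
  ((g.supportedOn hf).exists_first_essential g.2.2).choose_spec.1

theorem label_le (hf : SupportedOn π f) (g : ReducedNode π f) {v : V} (hv : Essential g.1 v) :
    π.idxOf (g.label hf) ≤ π.idxOf v :=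
  ((g.supportedOn hf).exists_first_essential g.2.2).choose_spec.2 v hv

theorem label_mem (hf : SupportedOn π f) (g : ReducedNode π f) : g.label hf ∈ π :=
  (g.supportedOn hf).mem_of_essential (g.essential_label hf)

theorem exists_update_eq (hf : SupportedOn π f) (g : ReducedNode π f) (b : Bool) :
    ∃ k a, (fun z => g.1 (Function.update z (g.label hf) b)) = subfunction π f k a := by
  have h1 := g.essential_label hf
  have h2 := fun w => g.label_le hf (v := w)
  generalize g.label hf = v at h1 h2
  obtain ⟨_, ⟨k, a, rfl⟩, _⟩ := g
  exact ⟨_, _, update_subfunction hf h1 h2 b⟩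

open Classical in
/-- The node or sink for a subfunction. -/
noncomputable def ofFunction (g : (V → Bool) → Bool) (hg : ∃ k a, g = subfunction π f k a) :
    ReducedNode π f ⊕ Bool :=
  if h : IsConstant g then Sum.inr (g fun _ => false) else Sum.inl ⟨g, hg, h⟩

noncomputable def child (hf : SupportedOn π f) (g : ReducedNode π f) (b : Bool) :
    ReducedNode π f ⊕ Bool :=
  ofFunction _ (g.exists_update_eq hf b)

theorem ofFunction_eq_inl {g : (V → Bool) → Bool} {hg : ∃ k a, g = subfunction π f k a}
    {w : ReducedNode π f} (h : ofFunction g hg = Sum.inl w) : w.1 = g := by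
  unfold ofFunction at h
  split_ifs at h
  cases h
  rfl

theorem label_child (hf : SupportedOn π f) (g : ReducedNode π f) (b : Bool) (w : ReducedNode π f)
    (h : g.child hf b = Sum.inl w) : π.idxOf (g.label hf) < π.idxOf (w.label hf) := by
  have hw := ofFunction_eq_inl h
  obtain ⟨z, hz⟩ := w.essential_label hf
  rw [hw] at hz
  have hne : w.label hf ≠ g.label hf := by
    intro he
    simp [he] at hz
  refine lt_of_le_of_ne (g.label_le hf ⟨Function.update z (g.label hf) b, ?_⟩) fun he =>
    hne ((List.idxOf_inj (g.label_mem hf)).1 he).symm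
  rwa [Function.update_comm hne.symm, Function.update_comm hne.symm]

theorem reachable (hf : SupportedOn π f) (hπ : π.Nodup) (k : ℕ) (a : V → Bool)
    (hc : ¬ IsConstant (subfunction π f k a)) :
    Relation.ReflTransGen (fun p q => ∃ w b, p = Sum.inl w ∧ q = child hf w b)
      (ofFunction f ⟨0, a, (subfunction_zero π f a).symm⟩)
      (Sum.inl ⟨subfunction π f k a, ⟨k, a, rfl⟩, hc⟩) := by
  induction k with
  | zero =>
    have : ofFunction f ⟨0, a, (subfunction_zero π f a).symm⟩ =
        Sum.inl ⟨subfunction π f 0 a, ⟨0, a, rfl⟩, hc⟩ := by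
      have hc' := hc
      rw [subfunction_zero] at hc'
      simp [ofFunction, hc', subfunction_zero]
    rw [this]
  | succ k ih =>
    rcases subfunction_succ hf hπ k a with h | ⟨v, hv, hvk, h⟩
    · have hc' := hc
      rw [h] at hc'
      have he : (⟨subfunction π f (k + 1) a, ⟨k + 1, a, rfl⟩, hc⟩ : ReducedNode π f) =
          ⟨subfunction π f k a, ⟨k, a, rfl⟩, hc'⟩ := Subtype.ext h
      rw [he]
      exact ih hc'
    · have hc' : ¬ IsConstant (subfunction π f k a) := fun hcon => hv.elim fun z hz => hz (hcon _ _)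
      refine (ih hc').tail ⟨_, a v, rfl, ?_⟩
      have hlab : label hf ⟨subfunction π f k a, ⟨k, a, rfl⟩, hc'⟩ = v := by
        refine (List.idxOf_inj (label_mem hf _)).1 (le_antisymm (label_le hf _ hv) ?_)
        rw [hvk]
        exact le_idxOf_of_essential_subfunction
          (essential_label hf ⟨subfunction π f k a, ⟨k, a, rfl⟩, hc'⟩)
      have hfun : (fun z => subfunction π f k a (Function.update z
          (label hf ⟨subfunction π f k a, ⟨k, a, rfl⟩, hc'⟩) (a v))) =
            subfunction π f (k + 1) a := by rw [hlab, h]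
      simp only [child, ofFunction, hfun]
      rw [dif_neg (by rwa [hfun])]

end ReducedNode

/-- The reduced OBDD of a function that is supported on `π`. -/
noncomputable def reduced (hπ : π.Nodup) (f : (V → Bool) → Bool) (hf : SupportedOn π f) :
    OBDD π where
  Node := ReducedNode π f
  fintype := @Fintype.ofFinite _ (finite_reducedNode hf)
  label := ReducedNode.label hf
  child := ReducedNode.child hf
  root := ReducedNode.ofFunction f ⟨0, fun _ => false, (subfunction_zero π f _).symm⟩
  label_mem := ReducedNode.label_mem hf
  ordered := ReducedNode.label_child hf
  reachable := by
    rintro ⟨_, ⟨k, a, rfl⟩, hc⟩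
    exact ReducedNode.reachable hf hπ k a hc

variable {f : (V → Bool) → Bool}

/-- The subfunction at a node of the reduced OBDD. -/
def nodeFunction {hπ : π.Nodup} {hf : SupportedOn π f} (g : (reduced hπ f hf).Node) :
    (V → Bool) → Bool :=
  Subtype.val (p := fun g => (∃ k a, g = subfunction π f k a) ∧ ¬ IsConstant g) g

theorem evalFrom_reduced_inl (hπ : π.Nodup) (hf : SupportedOn π f) (a : V → Bool)
    (g : (reduced hπ f hf).Node) :
    (reduced hπ f hf).evalFrom a (Sum.inl g) = nodeFunction g a := by
  induction hn : (reduced hπ f hf).rank (Sum.inl g) using Nat.strong_induction_on generalizing g with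
  | _ n ih =>
    subst hn
    rw [evalFrom_inl]
    have hlt := (reduced hπ f hf).rank_child_lt g (a ((reduced hπ f hf).label g))
    rcases hch : (reduced hπ f hf).child g (a ((reduced hπ f hf).label g)) with w | c
    · rw [hch] at hlt
      rw [ih _ hlt w rfl]
      have h := ReducedNode.ofFunction_eq_inl (hg := ReducedNode.exists_update_eq hf g _) hch
      refine (congrFun h a).trans ?_
      exact congrArg g.1 (Function.update_eq_self _ _)
    · rw [evalFrom_inr]
      change ReducedNode.ofFunction _ (ReducedNode.exists_update_eq hf g _) = _ at hch
      unfold ReducedNode.ofFunction at hch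
      split_ifs at hch with hcon
      cases hch
      exact (hcon _ a).trans (congrArg g.1 (Function.update_eq_self _ _))

theorem eval_reduced (hπ : π.Nodup) (hf : SupportedOn π f) (a : V → Bool) :
    (reduced hπ f hf).eval a = f a := by
  unfold eval
  rcases hr : (reduced hπ f hf).root with w | c
  · rw [evalFrom_reduced_inl]
    exact congrFun (ReducedNode.ofFunction_eq_inl
      (hg := ⟨0, fun _ => false, (subfunction_zero π f _).symm⟩) hr) a
  · rw [evalFrom_inr]
    change ReducedNode.ofFunction f ⟨0, fun _ => false, (subfunction_zero π f _).symm⟩ = _ at hr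
    unfold ReducedNode.ofFunction at hr
    split_ifs at hr with hcon
    cases hr
    exact hcon _ _

/-- Any OBDD for `f` computes each nonconstant subfunction at some non-sink node, and different
functions need different nodes. -/
theorem isMinimized_reduced (hπ : π.Nodup) (hf : SupportedOn π f) :
    (reduced hπ f hf).IsMinimized := by
  intro B hB
  have hB' : ∀ a, B.evalFrom a B.root = f a := fun a => (hB a).trans (eval_reduced hπ hf a)
  have key : ∀ g : ReducedNode π f, ∃ w : B.Node, ∀ z, g.1 z = B.evalFrom z (Sum.inl w) := by
    rintro ⟨_, ⟨k, a, rfl⟩, hc⟩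
    obtain ⟨q, hq⟩ := B.exists_evalFrom_mix k a B.root
    rcases q with w | c
    · exact ⟨w, fun z => by rw [← hq, hB']; rfl⟩
    · refine absurd (fun y z => ?_) hc
      change f _ = f _
      rw [← hB', ← hB', hq, hq, evalFrom_inr, evalFrom_inr]
  choose w hw using key
  have hinj : Function.Injective w := fun g g' h => Subtype.ext (funext fun z => by rw [hw, hw, h])
  exact Nat.add_le_add_right
    (@Fintype.card_le_of_injective _ _ (reduced hπ f hf).fintype _ w hinj) 2

/-- The side conditions of projection and universal reduction refer to labels; this turns them into
conditions on the represented function. -/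
theorem mem_vars_reduced (hπ : π.Nodup) (hf : SupportedOn π f) (v : V) :
    v ∈ (reduced hπ f hf).vars ↔ Essential f v := by
  constructor
  · rintro ⟨g, rfl⟩
    have hE := ReducedNode.essential_label hf g
    change Essential f (ReducedNode.label hf g)
    generalize ReducedNode.label hf g = v at hE
    obtain ⟨_, ⟨k, a, rfl⟩, _⟩ := g
    have hk := le_idxOf_of_essential_subfunction hE
    obtain ⟨z, hz⟩ := hE
    refine ⟨mix π k a z, fun h => hz ?_⟩
    have hm : ∀ b, mix π k a (Function.update z v b) = Function.update (mix π k a z) v b := by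
      intro b
      funext w
      by_cases hw : w = v
      · subst hw; simp [mix, hk]
      · simp [mix, hw]
    simpa only [subfunction, hm] using h
  · rintro ⟨z, hz⟩
    by_contra hv
    refine hz ?_
    rw [← eval_reduced hπ hf, ← eval_reduced hπ hf]
    unfold eval
    generalize (reduced hπ f hf).root = p
    induction hn : (reduced hπ f hf).rank p using Nat.strong_induction_on generalizing p with
    | _ n ih =>
      subst hn
      rcases p with g | c
      · have hg : (reduced hπ f hf).label g ≠ v := fun h => hv ⟨g, h⟩
        rw [evalFrom_inl, evalFrom_inl, Function.update_of_ne hg, Function.update_of_ne hg]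
        exact ih _ (rank_child_lt _ g _) _ rfl
      · rw [evalFrom_inr, evalFrom_inr]

theorem size_reduced_le (hπ : π.Nodup) (hf : SupportedOn π f) (W : ℕ)
    (hW : ∀ k < π.length, (Set.range (subfunction π f k)).ncard ≤ W) :
    (reduced hπ f hf).size ≤ π.length * W + 2 := by
  refine Nat.add_le_add_right ?_ 2
  have h1 : Fintype.card (reduced hπ f hf).Node =
      {g | (∃ k a, g = subfunction π f k a) ∧ ¬ IsConstant g}.ncard := by
    rw [← Nat.card_eq_fintype_card]
    rfl
  rw [h1]
  refine (Set.ncard_le_ncard (reducedNode_subset hf)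
    (Set.finite_iUnion fun k : Fin π.length => finite_range_subfunction hf k)).trans ?_
  calc _ ≤ ∑ k : Fin π.length, (Set.range (subfunction π f k)).ncard := by
        simpa using Finset.set_ncard_biUnion_le Finset.univ
          (fun k : Fin π.length => Set.range (subfunction π f k))
    _ ≤ ∑ _k : Fin π.length, W := Finset.sum_le_sum fun k _ => hW k k.2
    _ = _ := by simp

end OBDD

/-! ### Counting the subfunctions of local conjunctions -/

open Classical in
noncomputable def boolFunction {V : Type} (Q : (V → Bool) → Prop) : (V → Bool) → Bool :=
  fun a => decide (Q a)

theorem boolFunction_eq_true {V : Type} {Q : (V → Bool) → Prop} {a : V → Bool} :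
    boolFunction Q a = true ↔ Q a := by
  simp [boolFunction]

/-- The conjunction of the constraints `K`, with the variables in `P` projected out. -/
def ProjectedConj {V ι : Type} (P : Set V) (K : ι → (V → Bool) → Prop) (a : V → Bool) : Prop :=
  ∃ ρ : V → Bool, (∀ v, v ∉ P → ρ v = a v) ∧ ∀ j, K j ρ

section Counting

variable {V ι : Type} [DecidableEq V] {π : List V} {P : Set V} {K : ι → (V → Bool) → Prop}
  {bag : ι → Set V}

theorem supportedOn_projectedConj (hK : ∀ j a b, (∀ v ∈ bag j, a v = b v) → K j a → K j b)
    (hbag : ∀ j, ∀ v ∈ bag j, v ∈ π) : SupportedOn π (boolFunction (ProjectedConj P K)) := by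
  have key : ∀ a b : V → Bool, (∀ v ∈ π, a v = b v) → ProjectedConj P K a → ProjectedConj P K b := by
    classical
    rintro a b hab ⟨ρ, hρ, hall⟩
    refine ⟨fun v => if v ∈ π then ρ v else b v, fun v hv => ?_, fun j => hK j ρ _ (fun v hv => ?_)
      (hall j)⟩
    · by_cases hvπ : v ∈ π
      · simp [hvπ, hρ v hv, hab]
      · simp [hvπ]
    · simp [hbag j v hv]
  intro a b hab
  rw [Bool.eq_iff_iff, boolFunction_eq_true, boolFunction_eq_true]
  exact ⟨key a b hab, key b a fun v hv => (hab v hv).symm⟩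

/-- If, for a cut of the variable order, each constraint lies left of the cut or meets the variables
left of the cut only in `S`, then there are at most `2 ^ 2 ^ |S|` subfunctions at this cut. -/
theorem ncard_range_subfunction_le (hK : ∀ j a b, (∀ v ∈ bag j, a v = b v) → K j a → K j b)
    (k : ℕ) (S : Finset V) (J : Set ι) (hJ : ∀ j ∈ J, ∀ v ∈ bag j, π.idxOf v < k)
    (hS : ∀ j ∉ J, ∀ v ∈ bag j, π.idxOf v < k → v ∈ S) :
    (Set.range (subfunction π (boolFunction (ProjectedConj P K)) k)).ncard ≤ 2 ^ 2 ^ S.card := by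
  classical
  -- `T a` collects the patterns on `S` realized by left parts that agree with `a` off `P` and
  -- satisfy the constraints in `J`. The right-hand side of the cut sees nothing else of `a`, and
  -- there are `2 ^ 2 ^ |S|` sets of patterns.
  let T : (V → Bool) → Set (S → Bool) := fun a =>
    {r | ∃ ρ : V → Bool, (∀ v, π.idxOf v < k → v ∉ P → ρ v = a v) ∧ (∀ j ∈ J, K j ρ) ∧
      ∀ v : S, ρ v = r v}
  have hT : ∀ a a' z, T a = T a' → ProjectedConj P K (mix π k a z) →
      ProjectedConj P K (mix π k a' z) := by
    rintro a a' z haa ⟨ρ, hρ, hall⟩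
    have hmem : (fun v : S => ρ v) ∈ T a := by
      refine ⟨ρ, fun v hv hvP => ?_, fun j _ => hall j, fun v => rfl⟩
      simpa [mix, hv] using hρ v hvP
    rw [haa] at hmem
    obtain ⟨ρ', h1, h2, h3⟩ := hmem
    -- Glue the left part of `ρ'` to the right part of `ρ`; constraints across the cut survive
    -- because the two agree on `S`.
    refine ⟨fun v => if π.idxOf v < k then ρ' v else ρ v, fun v hv => ?_, fun j => ?_⟩
    · by_cases hvk : π.idxOf v < k
      · simp [mix, hvk, h1 v hvk hv]
      · simp [mix, hvk, hρ v hv]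
    · by_cases hj : j ∈ J
      · exact hK j ρ' _ (fun v hv => by simp [hJ j hj v hv]) (h2 j hj)
      · refine hK j ρ _ (fun v hv => ?_) (hall j)
        by_cases hvk : π.idxOf v < k
        · simpa [hvk] using (h3 ⟨v, hS j hj v hv hvk⟩).symm
        · simp [hvk]
  have hfac : ∀ a a', T a = T a' → subfunction π (boolFunction (ProjectedConj P K)) k a =
      subfunction π (boolFunction (ProjectedConj P K)) k a' := by
    intro a a' h
    funext z
    rw [Bool.eq_iff_iff]
    unfold subfunction
    rw [boolFunction_eq_true, boolFunction_eq_true]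
    exact ⟨hT a a' z h, hT a' a z h.symm⟩
  have hsub : Set.range (subfunction π (boolFunction (ProjectedConj P K)) k) ⊆
      (fun t => subfunction π (boolFunction (ProjectedConj P K)) k (Function.invFun T t)) ''
        Set.univ := by
    rintro _ ⟨a, rfl⟩
    exact ⟨T a, trivial, hfac _ _ (Function.invFun_eq ⟨a, rfl⟩)⟩
  refine (Set.ncard_le_ncard hsub (Set.toFinite _)).trans ((Set.ncard_image_le).trans ?_)
  rw [Set.ncard_univ, Nat.card_eq_fintype_card]
  simp

end Counting

/-! ### Derivations on the level of Boolean functions -/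

section Derivations

variable {V : Type} [DecidableEq V] {Φ : PCNF V} {π : List V} {W : ℕ}

/-- `Q` is supported on `π` and has at most `W` subfunctions at each cut. -/
def NarrowOn (π : List V) (W : ℕ) (Q : (V → Bool) → Prop) : Prop :=
  SupportedOn π (boolFunction Q) ∧
    ∀ k < π.length, (Set.range (subfunction π (boolFunction Q) k)).ncard ≤ W

/-- `Q` is derived from members of `L` by a rule of OBDD(∧, ∃, ∀). -/
def DerivedFrom (Φ : PCNF V) (L : List ((V → Bool) → Prop)) (Q : (V → Bool) → Prop) : Prop :=
  (∃ Q₁ ∈ L, ∃ Q₂ ∈ L, ∀ a, Q a ↔ Q₁ a ∧ Q₂ a) ∨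
  (∃ Q₁ ∈ L, ∃ x, Essential (boolFunction Q₁) x ∧
    ∀ a, Q a ↔ Q₁ (Function.update a x false) ∨ Q₁ (Function.update a x true)) ∨
  ∃ Q₁ ∈ L, ∃ u, Essential (boolFunction Q₁) u ∧ Φ.IsUniversal u ∧
    (∀ v, Essential (boolFunction Q₁) v → v ≠ u → Φ.LeftOf v u) ∧
    ∃ c : Bool, ∀ a, Q a ↔ Q₁ (Function.update a u c)

/-- The rules only look at the represented functions and their essential variables, so lines are
handled as predicates; diagrams enter only in `IsDerivation.exists_refutation`. -/
structure IsDerivation (Φ : PCNF V) (π : List V) (W : ℕ) (L : List ((V → Bool) → Prop)) : Prop where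
  length_le : Φ.matrix.length ≤ L.length
  input : ∀ (i : ℕ) (h : i < L.length) (h' : i < Φ.matrix.length) (a : V → Bool),
    L[i] a ↔ Φ.matrix[i].Sat a
  narrow : ∀ Q ∈ L, NarrowOn π W Q
  derived : ∀ (i : ℕ) (h : i < L.length), Φ.matrix.length ≤ i → DerivedFrom Φ (L.take i) L[i]

theorem isDerivation_matrix (h : ∀ C ∈ Φ.matrix, NarrowOn π W fun a => C.Sat a) :
    IsDerivation Φ π W (Φ.matrix.map fun C a => C.Sat a) where
  length_le := by simp
  input i h h' a := by simp
  narrow Q hQ := by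
    obtain ⟨C, hC, rfl⟩ := List.mem_map.1 hQ
    exact h C hC
  derived i h h' := by
    rw [List.length_map] at h
    omega

theorem IsDerivation.append {L : List ((V → Bool) → Prop)} (hL : IsDerivation Φ π W L)
    {Q : (V → Bool) → Prop} (hQ : NarrowOn π W Q) (hD : DerivedFrom Φ L Q) :
    IsDerivation Φ π W (L ++ [Q]) where
  length_le := hL.length_le.trans (by simp)
  input i h h' a := by
    have hi := h'.trans_le hL.length_le
    rw [List.getElem_append_left hi]
    exact hL.input i hi h' a
  narrow R hR := by
    rcases List.mem_append.1 hR with hR | hR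
    · exact hL.narrow R hR
    · rw [List.mem_singleton.1 hR]
      exact hQ
  derived i h h' := by
    rcases lt_or_ge i L.length with hi | hi
    · rw [List.getElem_append_left hi, List.take_append_of_le_length hi.le]
      exact hL.derived i hi h'
    · have hi' : i = L.length := by simp at h; omega
      subst hi'
      simpa using hD

theorem IsDerivation.exists_refutation {L : List ((V → Bool) → Prop)}
    (hL : IsDerivation Φ π W (L ++ [fun _ => False])) (hπ : π.Nodup) (hmem : ∀ v, v ∈ π ↔ v ∈ Φ.vars) :
    ∃ P : OBDDRefutation Φ, P.size ≤ (L.length + 1) * (π.length * W + 2) := by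
  have hlen : (L ++ [fun _ : V → Bool => False]).length = L.length + 1 := by simp
  generalize hL' : L ++ [fun _ : V → Bool => False] = L' at hL hlen
  have hnar : ∀ i : Fin (L.length + 1), NarrowOn π W L'[i] := fun i =>
    hL.narrow _ (List.getElem_mem _)
  let line : Fin (L.length + 1) → OBDD π := fun i => OBDD.reduced hπ (boolFunction L'[i]) (hnar i).1
  have heval : ∀ i a, (line i).eval a = boolFunction L'[i] a := fun i a => OBDD.eval_reduced _ _ _
  have hvars : ∀ i v, v ∈ (line i).vars ↔ Essential (boolFunction L'[i]) v := fun i v =>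
    OBDD.mem_vars_reduced _ _ _
  have htake : ∀ (i : Fin (L.length + 1)) Q, Q ∈ L'.take i → ∃ j, j < i ∧ Q = L'[j] := by
    intro i Q hQ
    obtain ⟨j, hj, rfl⟩ := List.mem_take_iff_getElem.1 hQ
    rw [lt_min_iff] at hj
    exact ⟨⟨j, by omega⟩, hj.1, rfl⟩
  refine ⟨{ order := π
            order_nodup := hπ
            mem_order := hmem
            last := L.length
            line := line
            minimized := fun i => OBDD.isMinimized_reduced _ _
            length_le := hlen ▸ hL.length_le
            input := fun i h a => ?_
            derived := fun i hi => ?_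
            final := fun a => ?_ }, ?_⟩
  · rw [heval, boolFunction_eq_true]
    exact hL.input i _ h a
  · rcases hL.derived i (by omega) hi with ⟨Q₁, h1, Q₂, h2, h⟩ | ⟨Q₁, h1, x, hx, h⟩ |
      ⟨Q₁, h1, u, hu, hU, hleft, c, h⟩
    · obtain ⟨j, hj, rfl⟩ := htake i Q₁ h1
      obtain ⟨k, hk, rfl⟩ := htake i Q₂ h2
      refine Or.inl ⟨j, k, hj, hk, fun a => ?_⟩
      rw [Bool.eq_iff_iff, Bool.and_eq_true, heval, heval, heval, boolFunction_eq_true,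
        boolFunction_eq_true, boolFunction_eq_true]
      exact h a
    · obtain ⟨j, hj, rfl⟩ := htake i Q₁ h1
      refine Or.inr (Or.inl ⟨j, hj, x, (hvars j x).2 hx, fun a => ?_⟩)
      rw [Bool.eq_iff_iff, Bool.or_eq_true, heval, heval, heval, boolFunction_eq_true,
        boolFunction_eq_true, boolFunction_eq_true]
      exact h a
    · obtain ⟨j, hj, rfl⟩ := htake i Q₁ h1
      refine Or.inr (Or.inr ⟨j, hj, u, (hvars j u).2 hu, hU,
        fun v hv hne => hleft v ((hvars j v).1 hv) hne, c, fun a => ?_⟩)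
      rw [Bool.eq_iff_iff, heval, heval, boolFunction_eq_true, boolFunction_eq_true]
      exact h a
  · rw [heval, ← Bool.not_eq_true, boolFunction_eq_true]
    subst hL'
    simp
  · refine (Finset.sum_le_sum fun i _ => OBDD.size_reduced_le hπ (hnar i).1 W (hnar i).2).trans ?_
    simp

end Derivations

/-! ### The variables and clauses of the modified equality formulas -/

/-- The index of a variable. -/
def Var.idx : Var → ℕ
  | x i => i
  | u i => i
  | t i => i
  | e i => i

/-- The position of the quantifier block of a variable. -/
def Var.kind : Var → ℕ
  | x _ => 0
  | u _ => 1
  | t _ => 2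
  | e _ => 3

theorem List.idxOf_lt_idxOf_iff_of_pairwise {α : Type*} [DecidableEq α] {l : List α} {key : α → ℕ}
    (hl : l.Pairwise fun a b => key a < key b) {a b : α} (ha : a ∈ l) (hb : b ∈ l) :
    l.idxOf a < l.idxOf b ↔ key a < key b := by
  have hmono : ∀ {a b : α}, a ∈ l → b ∈ l → l.idxOf a < l.idxOf b → key a < key b := by
    intro a b ha hb h
    have := List.pairwise_iff_getElem.1 hl _ _ (List.idxOf_lt_length_of_mem ha)
      (List.idxOf_lt_length_of_mem hb) h
    simpa using this
  refine ⟨hmono ha hb, fun h => ?_⟩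
  rcases lt_trichotomy (l.idxOf a) (l.idxOf b) with h' | h' | h'
  · exact h'
  · rw [(List.idxOf_inj ha).1 h'] at h
    omega
  · have := hmono hb ha h'
    omega

section EqPrime

variable {n : ℕ} (hn : 2 ≤ n)

theorem mem_vars_eqPrime {v : Var} : v ∈ (eqPrime n hn).vars ↔ 1 ≤ v.idx ∧ v.idx ≤ n := by
  cases v <;> simp [eqPrime, PCNF.vars, Var.idx] <;> omega

/-- The prefix consists of four blocks of length `n`, so `kind * n + idx` is the position in the
prefix, counted from 1. -/
theorem leftOf_eqPrime {v w : Var} : (eqPrime n hn).LeftOf v w ↔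
    (1 ≤ v.idx ∧ v.idx ≤ n) ∧ (1 ≤ w.idx ∧ w.idx ≤ n) ∧
      v.kind * n + v.idx < w.kind * n + w.idx := by
  unfold PCNF.LeftOf
  rw [mem_vars_eqPrime, mem_vars_eqPrime]
  refine and_congr_right fun hv => and_congr_right fun hw => ?_
  refine List.idxOf_lt_idxOf_iff_of_pairwise (key := fun v : Var => v.kind * n + v.idx) ?_
    ((mem_vars_eqPrime hn).2 hv) ((mem_vars_eqPrime hn).2 hw)
  simp only [PCNF.vars, eqPrime, List.map_append, List.map_map, List.pairwise_append,
    List.pairwise_map, List.mem_append, List.mem_map, Function.comp, List.mem_range'_1, Var.kind,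
    Var.idx]
  have := List.pairwise_lt_range' (s := 1) (n := n)
  refine ⟨⟨⟨?_, ?_, ?_⟩, ?_, ?_⟩, ?_, ?_⟩
  all_goals first
    | exact this.imp fun h => by omega
    | (intro a ha b hb; grind [Var.kind, Var.idx])

theorem isUniversal_eqPrime {v : Var} : (eqPrime n hn).IsUniversal v ↔
    v.kind = 1 ∧ 1 ≤ v.idx ∧ v.idx ≤ n := by
  cases v <;> simp [eqPrime, PCNF.IsUniversal, Var.idx, Var.kind]
  all_goals omega

theorem isExistential_eqPrime {v : Var} : (eqPrime n hn).IsExistential v ↔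
    v.kind ≠ 1 ∧ 1 ≤ v.idx ∧ v.idx ≤ n := by
  cases v <;> simp [eqPrime, PCNF.IsExistential, Var.idx, Var.kind]
  all_goals omega

theorem isUniversal_u {i : ℕ} (hi : 1 ≤ i ∧ i ≤ n) : (eqPrime n hn).IsUniversal (Var.u i) :=
  (isUniversal_eqPrime hn).2 ⟨rfl, hi⟩

theorem play_x (f : Var → (Var → Bool) → Bool) (τ : Var → Bool) {i : ℕ} (hi : 1 ≤ i ∧ i ≤ n) :
    (eqPrime n hn).play f τ (Var.x i) = τ (Var.x i) :=
  PCNF.play_existential _ _ _ _ ((isExistential_eqPrime hn).2 ⟨by simp [Var.kind], hi⟩)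

theorem length_matrix_eqPrime : (eqPrime n hn).matrix.length = 3 * n := by
  simp [eqPrime]
  omega

/-- The cases of the definition of the matrix. -/
theorem mem_matrix_eqPrime {C : Clause Var} : C ∈ (eqPrime n hn).matrix ↔
    (∃ i, (1 ≤ i ∧ i ≤ n) ∧ (C = {(Var.x i, true), (Var.u i, true), (Var.t i, false)} ∨
      C = {(Var.x i, false), (Var.u i, false), (Var.t i, false)})) ∨
    C = {(Var.t 1, true), (Var.e 1, true)} ∨
    (∃ i, (2 ≤ i ∧ i < n) ∧ C = {(Var.e (i - 1), false), (Var.t i, true), (Var.e i, true)}) ∨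
    C = {(Var.e (n - 1), false), (Var.t n, true)} := by
  simp only [eqPrime, List.mem_append, List.mem_flatMap, List.mem_map, List.mem_cons,
    List.not_mem_nil, or_false, List.mem_range'_1, or_assoc]
  refine or_congr (exists_congr fun i => and_congr_left fun _ => by omega)
    (or_congr_right (or_congr_left (exists_congr fun i => ?_)))
  rw [show (2 ≤ i ∧ i < 2 + (n - 2)) ↔ (2 ≤ i ∧ i < n) by omega, eq_comm]

/-- The `i`-th block of constraints of a chain in which `t i` forces `R i` on `x i` and `u i`. -/
def BlockSat (n : ℕ) (R : ℕ → Bool → Bool → Prop) (i : ℕ) (ρ : Var → Bool) : Prop :=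
  (ρ (Var.t i) = true → R i (ρ (Var.x i)) (ρ (Var.u i))) ∧
    (i = 1 ∨ ρ (Var.e (i - 1)) = true → ρ (Var.t i) = true ∨ i < n ∧ ρ (Var.e i) = true)

/-- The two clauses with `x i` and `u i` say that `t i` implies `x i ≠ u i`. The special first and
last chain clauses fit the general link because `BlockSat` treats `e 0` as true and `e n` as false.
-/
theorem matrix_eqPrime_sat_iff (a : Var → Bool) : (∀ C ∈ (eqPrime n hn).matrix, C.Sat a) ↔
    ∀ i, 1 ≤ i → i ≤ n → BlockSat n (fun _ b c => b ≠ c) i a := by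
  constructor
  · intro h i h1 h2
    constructor
    · intro ht hxu
      have c1 := h {(Var.x i, true), (Var.u i, true), (Var.t i, false)}
        ((mem_matrix_eqPrime hn).2 (Or.inl ⟨i, ⟨h1, h2⟩, Or.inl rfl⟩))
      have c2 := h {(Var.x i, false), (Var.u i, false), (Var.t i, false)}
        ((mem_matrix_eqPrime hn).2 (Or.inl ⟨i, ⟨h1, h2⟩, Or.inr rfl⟩))
      simp [Clause.Sat, ht, hxu] at c1 c2
      simp [c1] at c2
    · intro he
      rcases eq_or_ne i 1 with rfl | hi1
      · have c := h {(Var.t 1, true), (Var.e 1, true)}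
          ((mem_matrix_eqPrime hn).2 (Or.inr (Or.inl rfl)))
        simp [Clause.Sat] at c
        exact c.imp_right fun h => ⟨by omega, h⟩
      replace he := he.resolve_left hi1
      rcases eq_or_ne i n with rfl | hin
      · have c := h {(Var.e (i - 1), false), (Var.t i, true)}
          ((mem_matrix_eqPrime hn).2 (Or.inr (Or.inr (Or.inr rfl))))
        simp [Clause.Sat, he] at c
        exact Or.inl c
      · have c := h {(Var.e (i - 1), false), (Var.t i, true), (Var.e i, true)}
          ((mem_matrix_eqPrime hn).2 (Or.inr (Or.inr (Or.inl ⟨i, by omega, rfl⟩))))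
        simp [Clause.Sat, he] at c
        exact c.imp_right fun h => ⟨by omega, h⟩
  · intro h C hC
    rcases (mem_matrix_eqPrime hn).1 hC with ⟨i, hi, rfl | rfl⟩ | rfl | ⟨i, hi, rfl⟩ | rfl
    · have := (h i hi.1 hi.2).1
      simp [Clause.Sat]
      grind
    · have := (h i hi.1 hi.2).1
      simp [Clause.Sat]
      grind
    · have := (h 1 le_rfl (by omega)).2 (Or.inl rfl)
      simp [Clause.Sat]
      grind
    · have := (h i (by omega) (by omega)).2
      simp [Clause.Sat]
      grind
    · have := (h n (by omega) le_rfl).2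
      simp [Clause.Sat]
      grind

/-- If `R` failed everywhere, every `t i` would be false, and truth would propagate along `e 1, e 2,
…` up to `e n`, which the last link forbids. -/
theorem exists_of_forall_blockSat {R : ℕ → Bool → Bool → Prop} {ρ : Var → Bool} (h1n : 1 ≤ n)
    (h : ∀ i, 1 ≤ i → i ≤ n → BlockSat n R i ρ) :
    ∃ i, (1 ≤ i ∧ i ≤ n) ∧ R i (ρ (Var.x i)) (ρ (Var.u i)) := by
  by_contra! hR
  have ht : ∀ i, 1 ≤ i → i ≤ n → ¬ ρ (Var.t i) = true := fun i h1 h2 ht =>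
    hR i ⟨h1, h2⟩ ((h i h1 h2).1 ht)
  have he : ∀ i, 1 ≤ i → i ≤ n → i < n ∧ ρ (Var.e i) = true := by
    intro i hi
    induction i, hi using Nat.le_induction with
    | base => exact fun h2 => ((h 1 le_rfl h2).2 (Or.inl rfl)).resolve_left (ht 1 le_rfl h2)
    | succ i hi ih =>
      exact fun h2 => ((h (i + 1) (by omega) h2).2 (Or.inr (ih (by omega)).2)).resolve_left
        (ht _ (by omega) h2)
  exact lt_irrefl _ (he n h1n le_rfl).1

/-- The values of `t i` and `e i` that satisfy the chain if `R k` holds. -/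
def chainWitness (k : ℕ) (a : Var → Bool) : Var → Bool
  | Var.t i => decide (i = k)
  | Var.e i => decide (i < k)
  | v => a v

theorem blockSat_chainWitness {R : ℕ → Bool → Bool → Prop} {a : Var → Bool} {k : ℕ}
    (hk : 1 ≤ k ∧ k ≤ n) (hR : R k (a (Var.x k)) (a (Var.u k))) {i : ℕ} (hi : 1 ≤ i ∧ i ≤ n) :
    BlockSat n R i (chainWitness k a) := by
  constructor
  · intro h
    simp only [chainWitness, decide_eq_true_eq] at h
    subst h
    exact hR
  · simp only [chainWitness, decide_eq_true_eq]
    omega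

/-- A disjunction over all blocks is a projection of local constraints. This makes the width bound
applicable to it. -/
theorem exists_blockSat_iff {R : ℕ → Bool → Bool → Prop} {a : Var → Bool} (h1n : 1 ≤ n) :
    (∃ ρ : Var → Bool, (∀ i, ρ (Var.x i) = a (Var.x i)) ∧ (∀ i, ρ (Var.u i) = a (Var.u i)) ∧
      ∀ i, 1 ≤ i → i ≤ n → BlockSat n R i ρ) ↔
    ∃ i, (1 ≤ i ∧ i ≤ n) ∧ R i (a (Var.x i)) (a (Var.u i)) := by
  constructor
  · rintro ⟨ρ, hx, hu, h⟩
    simpa only [hx, hu] using exists_of_forall_blockSat h1n h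
  · rintro ⟨k, hk, hR⟩
    exact ⟨chainWitness k a, fun _ => rfl, fun _ => rfl, fun i h1 h2 =>
      blockSat_chainWitness hk hR ⟨h1, h2⟩⟩

theorem exists_ne_of_matrix_sat {a : Var → Bool} (h : ∀ C ∈ (eqPrime n hn).matrix, C.Sat a) :
    ∃ i, (1 ≤ i ∧ i ≤ n) ∧ a (Var.x i) ≠ a (Var.u i) :=
  exists_of_forall_blockSat (by omega) ((matrix_eqPrime_sat_iff hn a).1 h)

theorem matrix_sat_chainWitness {a : Var → Bool} {k : ℕ} (hk : 1 ≤ k ∧ k ≤ n)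
    (h : a (Var.x k) ≠ a (Var.u k)) : ∀ C ∈ (eqPrime n hn).matrix, C.Sat (chainWitness k a) :=
  (matrix_eqPrime_sat_iff hn _).2 fun _ h1 h2 => blockSat_chainWitness hk h ⟨h1, h2⟩

/-! ### Universal winning strategies -/

theorem isUniversalStrategy_eqStrategy : (eqPrime n hn).IsUniversalStrategy eqStrategy := by
  intro v hv τ σ h
  rw [isUniversal_eqPrime] at hv
  cases v with
  | u i =>
    refine h _ ((leftOf_eqPrime hn).2 ?_)
    simp only [Var.idx, Var.kind] at hv ⊢
    omega
  | _ => rfl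

theorem play_eqStrategy (τ : Var → Bool) {i : ℕ} (hi : 1 ≤ i ∧ i ≤ n) :
    (eqPrime n hn).play eqStrategy τ (Var.u i) = τ (Var.x i) := by
  rw [PCNF.play_universal _ _ (isUniversalStrategy_eqStrategy hn) _ _
    (isUniversal_u hn hi)]
  exact play_x hn _ _ hi

theorem isUniversalWinning_eqStrategy : (eqPrime n hn).IsUniversalWinning eqStrategy := by
  refine ⟨isUniversalStrategy_eqStrategy hn, fun τ => ?_⟩
  by_contra hc
  simp only [PCNF.Falsifies, not_exists, not_and, not_not] at hc
  obtain ⟨i, hi, hne⟩ := exists_ne_of_matrix_sat hn hc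
  rw [play_eqStrategy hn τ hi, play_x hn _ _ hi] at hne
  exact hne rfl

theorem play_universal_congr {f : Var → (Var → Bool) → Bool}
    (hf : (eqPrime n hn).IsUniversalStrategy f) {τ σ : Var → Bool}
    (h : ∀ i, τ (Var.x i) = σ (Var.x i)) (i : ℕ) (hi : 1 ≤ i ∧ i ≤ n) :
    (eqPrime n hn).play f τ (Var.u i) = (eqPrime n hn).play f σ (Var.u i) := by
  induction i using Nat.strong_induction_on with
  | _ i ih =>
    have hU := isUniversal_u hn hi
    rw [PCNF.play_universal _ _ hf _ _ hU, PCNF.play_universal _ _ hf _ _ hU]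
    refine hf _ hU _ _ fun v hv => ?_
    rw [leftOf_eqPrime] at hv
    cases v with
    | x j => rw [play_x hn (i := j) _ _ hv.1, play_x hn (i := j) _ _ hv.1, h]
    | u j =>
      simp only [Var.idx, Var.kind] at hv
      exact ih j (by omega) hv.1
    | _ =>
      simp only [Var.idx, Var.kind] at hv
      omega

/-- If `u i ≠ x i` in some play, let the existential player switch `t` and `e` to `chainWitness i`.
The `u`-moves precede `t` and `e`, so they stay the same, and the matrix becomes true. -/
theorem play_eq_of_isUniversalWinning {f : Var → (Var → Bool) → Bool}
    (hf : (eqPrime n hn).IsUniversalWinning f) (τ : Var → Bool) {i : ℕ} (hi : 1 ≤ i ∧ i ≤ n) :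
    (eqPrime n hn).play f τ (Var.u i) = τ (Var.x i) := by
  by_contra hne
  obtain ⟨C, hC, hfalse⟩ := hf.2 (chainWitness i τ)
  have hplay := (matrix_eqPrime_sat_iff hn (chainWitness i ((eqPrime n hn).play f τ))).2
    (fun j h1 h2 => blockSat_chainWitness hi (fun h => hne ?_) ⟨h1, h2⟩) C hC
  · refine hfalse ?_
    obtain ⟨l, hl, hlv⟩ := hplay
    refine ⟨l, hl, Eq.trans ?_ hlv⟩
    have hr := (mem_vars_eqPrime hn).1 ((eqPrime n hn).closed C hC l hl)
    generalize l.1 = v at hr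
    cases v with
    | x j =>
      exact (play_x hn (i := j) _ _ hr).trans (play_x hn (i := j) f τ hr).symm
    | u j =>
      exact play_universal_congr hn hf.1 (σ := τ) (τ := chainWitness i τ) (fun _ => rfl) j hr
    | _ => exact PCNF.play_existential _ _ _ _ ((isExistential_eqPrime hn).2 ⟨by simp [Var.kind], hr⟩)
  · rw [← h, play_x hn _ _ hi]

/-! ### Pathwidth -/

/-- The variables of the `i`-th block of constraints. -/
def blockBag (i : ℕ) : Finset Var :=
  {Var.x i, Var.u i, Var.t i, Var.e (i - 1), Var.e i}

theorem mem_blockBag {i : ℕ} {v : Var} : v ∈ blockBag i ↔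
    v.idx = i ∨ v.kind = 3 ∧ v.idx = i - 1 := by
  cases v <;> simp [blockBag, Var.idx, Var.kind]
  tauto

theorem card_blockBag_le (i : ℕ) : (blockBag i).card ≤ 5 := Finset.card_le_five

theorem exists_blockBag {C : Clause Var} (hC : C ∈ (eqPrime n hn).matrix) :
    ∃ i, (1 ≤ i ∧ i ≤ n) ∧ ∀ l ∈ C, l.1 ∈ blockBag i := by
  rcases (mem_matrix_eqPrime hn).1 hC with ⟨i, hi, rfl | rfl⟩ | rfl | ⟨i, hi, rfl⟩ | rfl
  · exact ⟨i, hi, by simp [mem_blockBag, Var.idx]⟩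
  · exact ⟨i, hi, by simp [mem_blockBag, Var.idx]⟩
  · exact ⟨1, by omega, by simp [mem_blockBag, Var.idx]⟩
  · exact ⟨i, by omega, by simp [mem_blockBag, Var.idx, Var.kind]⟩
  · exact ⟨n, by omega, by simp [mem_blockBag, Var.idx, Var.kind]⟩

-- Bags are counted from 0, hence the shift. Only the `e i` lie in two bags, and these are
-- consecutive; `e 0` in the first bag does not occur in the matrix and is dropped by `subtype`.
open Classical in
noncomputable def eqPathDecomposition : PathDecomposition (eqPrime n hn).primalGraph where
  len := n
  bag i := (blockBag (i + 1)).subtype _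
  vertex_mem := by
    rintro ⟨v, C, hC, b, hb⟩
    obtain ⟨i, hi, h⟩ := exists_blockBag hn hC
    refine ⟨⟨i - 1, by omega⟩, ?_⟩
    simpa [Nat.sub_add_cancel hi.1] using h _ hb
  edge_mem := by
    rintro ⟨v, _⟩ ⟨w, _⟩ ⟨-, C, hC, ⟨b, hb⟩, ⟨c, hc⟩⟩
    obtain ⟨i, hi, h⟩ := exists_blockBag hn hC
    refine ⟨⟨i - 1, by omega⟩, ?_⟩
    simpa [Nat.sub_add_cancel hi.1] using ⟨h _ hb, h _ hc⟩
  interval := by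
    rintro ⟨v, _⟩ i k j hik hkj
    simp only [Finset.mem_subtype, mem_blockBag]
    rw [Fin.le_def] at hik hkj
    omega

theorem pathwidth_eqPrime_le : (eqPrime n hn).pathwidth ≤ 4 := by
  classical
  refine (iInf_le _ (eqPathDecomposition hn)).trans ?_
  have h : (eqPathDecomposition hn).width ≤ 4 := by
    refine Nat.sub_le_sub_right (m := 5) (Finset.sup_le fun i _ => ?_) 1
    refine le_trans ?_ (card_blockBag_le (i + 1))
    exact (Finset.card_subtype _ _).trans_le (Finset.card_filter_le _ _)
  exact_mod_cast h

end EqPrime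

/-! ### Conjunction and projection of derived functions -/

theorem projectedConj_empty {V ι : Type} (K : ι → (V → Bool) → Prop) (a : V → Bool) :
    ProjectedConj ∅ K a ↔ ∀ j, K j a := by
  constructor
  · rintro ⟨ρ, hρ, h⟩
    rwa [show ρ = a from funext fun v => hρ v (by simp)] at h
  · exact fun h => ⟨a, fun _ _ => rfl, h⟩

section Derivations

variable {V : Type} [DecidableEq V] {Φ : PCNF V} {π : List V} {W : ℕ}

/-- Conjoin the clauses one by one; each intermediate line is the conjunction of an initial segment
of the matrix. -/
theorem exists_isDerivation_matrix_conj (hne : Φ.matrix ≠ [])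
    (h : ∀ A : List (Clause V), A ⊆ Φ.matrix → NarrowOn π W fun a => ∀ C ∈ A, C.Sat a) :
    ∃ L, IsDerivation Φ π W L ∧ (fun a => ∀ C ∈ Φ.matrix, C.Sat a) ∈ L ∧
      L.length ≤ 2 * Φ.matrix.length := by
  have hpos : 0 < Φ.matrix.length := List.length_pos_iff.2 hne
  have key : ∀ k, k + 1 ≤ Φ.matrix.length → ∃ L, IsDerivation Φ π W L ∧
      Φ.matrix.map (fun C a => C.Sat a) ⊆ L ∧
      (fun a => ∀ C ∈ Φ.matrix.take (k + 1), C.Sat a) ∈ L ∧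
      L.length ≤ Φ.matrix.length + k := by
    intro k
    induction k with
    | zero =>
      intro _
      refine ⟨_, isDerivation_matrix fun C hC => ?_, List.Subset.refl _, ?_, by simp⟩
      · simpa using h [C] (by simpa using hC)
      · refine List.mem_map.2 ⟨Φ.matrix[0], List.getElem_mem _, ?_⟩
        simp [List.take_one, List.head?_eq_getElem?, hpos]
    | succ k ih =>
      intro hk
      obtain ⟨L, hL, hsub, hmem, hlen⟩ := ih (by omega)
      refine ⟨_, hL.append (h (Φ.matrix.take (k + 1 + 1)) (List.take_subset _ _)) (Or.inl ⟨_, hmem,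
        fun a => Φ.matrix[k + 1].Sat a, hsub (List.mem_map.2 ⟨_, List.getElem_mem hk, rfl⟩),
        fun a => ?_⟩), fun Q hQ => List.mem_append_left _ (hsub hQ), by simp, by simp; omega⟩
      rw [List.take_succ_eq_append_getElem hk]
      simp only [List.mem_append, List.mem_singleton, or_imp, forall_and, forall_eq]
  obtain ⟨L, hL, -, hmem, hlen⟩ := key (Φ.matrix.length - 1) (by omega)
  refine ⟨L, hL, ?_, by omega⟩
  simpa [Nat.sub_add_cancel hpos] using hmem

theorem projectedConj_insert {ι : Type} (K : ι → (V → Bool) → Prop) (P : Set V) (w : V)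
    (a : V → Bool) : ProjectedConj (insert w P) K a ↔
      ProjectedConj P K (Function.update a w false) ∨ ProjectedConj P K (Function.update a w true) := by
  constructor
  · rintro ⟨ρ, hρ, h⟩
    have : ProjectedConj P K (Function.update a w (ρ w)) := by
      refine ⟨ρ, fun v hv => ?_, h⟩
      by_cases hvw : v = w
      · subst hvw; simp
      · rw [Function.update_of_ne hvw]
        exact hρ v (by simp [hvw, hv])
    cases hw : ρ w <;> rw [hw] at this
    · exact Or.inl this
    · exact Or.inr this
  · have : ∀ b, ProjectedConj P K (Function.update a w b) → ProjectedConj (insert w P) K a := by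
      rintro b ⟨ρ, hρ, h⟩
      refine ⟨ρ, fun v hv => ?_, h⟩
      rw [Set.mem_insert_iff, not_or] at hv
      rw [hρ v hv.2, Function.update_of_ne hv.1]
    rintro (h | h) <;> exact this _ h

theorem IsDerivation.exists_projectedConj {ι : Type} {K : ι → (V → Bool) → Prop}
    (h : ∀ P : Set V, NarrowOn π W (ProjectedConj P K)) {L : List ((V → Bool) → Prop)}
    (hL : IsDerivation Φ π W L) (hmem : ProjectedConj ∅ K ∈ L) (l : List V) :
    ∃ L', IsDerivation Φ π W L' ∧ ProjectedConj {v | v ∈ l} K ∈ L' ∧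
      L'.length ≤ L.length + l.length := by
  induction l with
  | nil => exact ⟨L, hL, by simpa using hmem, by simp⟩
  | cons w l ih =>
    obtain ⟨L', hL', hmem', hlen⟩ := ih
    have hset : {v | v ∈ w :: l} = insert w {v | v ∈ l} := by ext; simp
    rw [hset]
    -- Projection is only allowed on variables that occur in the line; for an inessential `w` it
    -- changes nothing and is skipped.
    by_cases hE : Essential (boolFunction (ProjectedConj {v | v ∈ l} K)) w
    · exact ⟨_, hL'.append (h _) (Or.inr (Or.inl ⟨_, hmem', w, hE, projectedConj_insert K _ w⟩)),
        by simp, by simp; omega⟩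
    · refine ⟨L', hL', ?_, by simp; omega⟩
      have : ProjectedConj (insert w {v | v ∈ l}) K = ProjectedConj {v | v ∈ l} K := by
        funext a
        refine propext ?_
        have hu : ∀ b, ProjectedConj {v | v ∈ l} K (Function.update a w b) ↔
            ProjectedConj {v | v ∈ l} K a := fun b => by
          rw [← boolFunction_eq_true (Q := ProjectedConj {v | v ∈ l} K),
            update_eq_of_not_essential hE, boolFunction_eq_true]
        rw [projectedConj_insert, hu, hu, or_self]
      rwa [this]

end Derivations

/-! ### The OBDD refutation -/

/-- The variable order in which the blocks of constraints are contiguous. -/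
def eqOrder (n : ℕ) : List Var :=
  (List.range' 1 n).flatMap fun i => [Var.x i, Var.u i, Var.t i, Var.e i]

theorem mem_eqOrder {n : ℕ} {v : Var} : v ∈ eqOrder n ↔ 1 ≤ v.idx ∧ v.idx ≤ n := by
  cases v <;> simp [eqOrder, Var.idx] <;> omega

theorem length_eqOrder (n : ℕ) : (eqOrder n).length = 4 * n := by
  simp [eqOrder, mul_comm]

theorem nodup_eqOrder (n : ℕ) : (eqOrder n).Nodup := by
  refine List.nodup_flatMap.2 ⟨fun i _ => by simp, ?_⟩
  refine (List.nodup_range' (s := 1) (n := n)).imp fun {i j} h => ?_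
  simp [Function.onFun, Ne.symm h]

theorem idxOf_flatMap_block (l : List ℕ) {v : Var} (hv : v.idx ∈ l) :
    (l.flatMap fun i => [Var.x i, Var.u i, Var.t i, Var.e i]).idxOf v =
      4 * l.idxOf v.idx + v.kind := by
  induction l with
  | nil => simp at hv
  | cons i l ih =>
    by_cases hi : i = v.idx
    · subst hi
      cases v <;> simp [Var.idx, Var.kind]
    · have hnot : v ∉ [Var.x i, Var.u i, Var.t i, Var.e i] := by
        cases v <;> simp [Var.idx] at hi ⊢ <;> omega
      rw [List.flatMap_cons, List.idxOf_append_of_notMem hnot, ih (by simpa [Ne.symm hi] using hv),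
        List.idxOf_cons_ne _ hi]
      simp
      ring

theorem idxOf_eqOrder {n : ℕ} {v : Var} (hv : 1 ≤ v.idx ∧ v.idx ≤ n) :
    (eqOrder n).idxOf v = 4 * (v.idx - 1) + v.kind := by
  have h : (List.range' 1 n).idxOf v.idx = v.idx - 1 := by
    have := (List.nodup_range' (s := 1) (n := n)).idxOf_getElem (v.idx - 1) (by simp; omega)
    rwa [List.getElem_range', show 1 + 1 * (v.idx - 1) = v.idx by omega] at this
  rw [eqOrder, idxOf_flatMap_block _ (by simp; omega), h]

theorem Var.kind_le (v : Var) : v.kind ≤ 3 := by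
  cases v <;> simp [Var.kind]

/-- The cut at `k` falls into block `k / 4 + 1`. Constraints of earlier blocks lie entirely left of
it, and all others reach to its left only inside the bag of that block, which has at most five
elements. -/
theorem narrowOn_projectedConj {n : ℕ} {ι : Type} {K : ι → (Var → Bool) → Prop}
    {bag : ι → Set Var} (hK : ∀ j a b, (∀ v ∈ bag j, a v = b v) → K j a → K j b)
    (hbag : ∀ j, ∃ i, ∀ v ∈ bag j, v ∈ blockBag i ∧ 1 ≤ v.idx ∧ v.idx ≤ n) (P : Set Var) :
    NarrowOn (eqOrder n) (2 ^ 2 ^ 5) (ProjectedConj P K) := by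
  refine ⟨supportedOn_projectedConj hK fun j v hv => ?_, fun k _ => ?_⟩
  · obtain ⟨i, hi⟩ := hbag j
    exact mem_eqOrder.2 (hi v hv).2
  refine (ncard_range_subfunction_le hK k (blockBag (k / 4 + 1))
    {j | ∀ v ∈ bag j, (eqOrder n).idxOf v < k} (fun j hj => hj) fun j hj v hv hvk => ?_).trans
      (Nat.pow_le_pow_right two_pos (Nat.pow_le_pow_right two_pos (card_blockBag_le _)))
  obtain ⟨i, hi⟩ := hbag j
  have hki : k < 4 * i := by
    by_contra! hki
    refine hj fun w hw => ?_
    obtain ⟨h1, h2⟩ := hi w hw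
    rw [idxOf_eqOrder h2]
    rw [mem_blockBag] at h1
    have := w.kind_le
    omega
  obtain ⟨h1, h2⟩ := hi v hv
  rw [idxOf_eqOrder h2] at hvk
  rw [mem_blockBag] at h1 ⊢
  omega

section EqPrime

variable {n : ℕ} (hn : 2 ≤ n)

theorem Clause.Sat.congr {V : Type} {C : Clause V} {a b : V → Bool} (h : ∀ l ∈ C, a l.1 = b l.1)
    (hC : C.Sat a) : C.Sat b := by
  obtain ⟨l, hl, hal⟩ := hC
  exact ⟨l, hl, (h l hl).symm.trans hal⟩

theorem narrowOn_projectedConj_clauses {A : List (Clause Var)} (hA : A ⊆ (eqPrime n hn).matrix)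
    (P : Set Var) : NarrowOn (eqOrder n) (2 ^ 2 ^ 5)
      (ProjectedConj P fun (C : {C // C ∈ A}) a => C.1.Sat a) := by
  refine narrowOn_projectedConj (bag := fun C : {C // C ∈ A} => {v | ∃ l ∈ C.1, l.1 = v})
    (fun C a b h => Clause.Sat.congr (C := C.1) fun l hl => h l.1 ⟨l, hl, rfl⟩) (fun C => ?_) P
  obtain ⟨i, -, hi⟩ := exists_blockBag hn (hA C.2)
  refine ⟨i, ?_⟩
  rintro _ ⟨l, hl, rfl⟩
  exact ⟨hi l hl, (mem_vars_eqPrime hn).1 ((eqPrime n hn).closed _ (hA C.2) l hl)⟩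

theorem narrowOn_clauses {A : List (Clause Var)} (hA : A ⊆ (eqPrime n hn).matrix) :
    NarrowOn (eqOrder n) (2 ^ 2 ^ 5) fun a => ∀ C ∈ A, C.Sat a := by
  have h := narrowOn_projectedConj_clauses hn hA ∅
  have he : (ProjectedConj ∅ fun (C : {C // C ∈ A}) a => C.1.Sat a) = fun a => ∀ C ∈ A, C.Sat a := by
    funext a
    simp [projectedConj_empty]
  rwa [he] at h

/-- Some pair `(x i, u i)` satisfies `R i`. -/
def SomeBlock (n : ℕ) (R : ℕ → Bool → Bool → Prop) (a : Var → Bool) : Prop :=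
  ∃ i, (1 ≤ i ∧ i ≤ n) ∧ R i (a (Var.x i)) (a (Var.u i))

/-- Agreement on the formula's variables suffices: `e 0` lies in the first bag but is not looked at
when `i = 1`. -/
theorem BlockSat.congr {R : ℕ → Bool → Bool → Prop} {i : ℕ} {a b : Var → Bool}
    (hi : 1 ≤ i ∧ i ≤ n) (h : ∀ v ∈ blockBag i, 1 ≤ v.idx ∧ v.idx ≤ n → a v = b v)
    (ha : BlockSat n R i a) : BlockSat n R i b := by
  have hx := h (Var.x i) (by simp [blockBag]) hi
  have hu := h (Var.u i) (by simp [blockBag]) hi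
  have ht := h (Var.t i) (by simp [blockBag]) hi
  have he := h (Var.e i) (by simp [blockBag]) hi
  have he' : i = 1 ∨ a (Var.e (i - 1)) = b (Var.e (i - 1)) :=
    or_iff_not_imp_left.2 fun h1 => h (Var.e (i - 1)) (by simp [blockBag]) (by
      simp only [Var.idx]
      omega)
  unfold BlockSat at ha ⊢
  rw [← hx, ← hu, ← ht, ← he]
  rcases he' with he' | he'
  · exact ⟨ha.1, fun _ => ha.2 (Or.inl he')⟩
  · rwa [← he']

/-- The chain for `R` serves only to bound the width, with `t` and `e` projected out; it need not be
a line of the refutation. Choosing `R` suitably covers every line of the reduction phase. -/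
theorem narrowOn_someBlock (h1n : 1 ≤ n) (R : ℕ → Bool → Bool → Prop) :
    NarrowOn (eqOrder n) (2 ^ 2 ^ 5) (SomeBlock n R) := by
  have h := narrowOn_projectedConj (n := n) (ι := {i // 1 ≤ i ∧ i ≤ n})
    (K := fun i => BlockSat n R i) (bag := fun i => {v | v ∈ blockBag i ∧ 1 ≤ v.idx ∧ v.idx ≤ n})
    (fun i a b h => BlockSat.congr i.2 fun v hv hv' => h v ⟨hv, hv'⟩)
    (fun i => ⟨i, fun v hv => hv⟩) {v | 2 ≤ v.kind}
  have he : (ProjectedConj {v : Var | 2 ≤ v.kind} fun i : {i // 1 ≤ i ∧ i ≤ n} => BlockSat n R i) =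
      SomeBlock n R := by
    funext a
    refine propext (Iff.trans ?_ (exists_blockSat_iff h1n))
    constructor
    · rintro ⟨ρ, hρ, hall⟩
      exact ⟨ρ, fun i => hρ _ (by simp [Var.kind]), fun i => hρ _ (by simp [Var.kind]),
        fun i h1 h2 => hall ⟨i, h1, h2⟩⟩
    · rintro ⟨ρ, hx, hu, hall⟩
      refine ⟨fun v => if 2 ≤ v.kind then ρ v else a v, fun v hv => if_neg hv, fun i => ?_⟩
      refine BlockSat.congr i.2 (fun v _ _ => ?_) (hall i i.2.1 i.2.2)
      cases v <;> simp [Var.kind, hx, hu]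
  rwa [he] at h

/-- Some pair `(x i, u i)` with `i ≤ m` consists of different values. -/
def DiffersBelow (n m : ℕ) : (Var → Bool) → Prop :=
  SomeBlock n fun i b c => i ≤ m ∧ b ≠ c

theorem differsBelow_of_essential {m : ℕ} {v : Var}
    (hv : Essential (boolFunction (DiffersBelow n m)) v) :
    v.kind ≤ 1 ∧ (1 ≤ v.idx ∧ v.idx ≤ n) ∧ v.idx ≤ m := by
  by_contra hc
  obtain ⟨a, ha⟩ := hv
  refine ha ?_
  rw [Bool.eq_iff_iff, boolFunction_eq_true, boolFunction_eq_true]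
  refine exists_congr fun i => and_congr_right fun hi => and_congr_right fun him => ?_
  have hx : Var.x i ≠ v := by
    rintro rfl
    exact hc ⟨by simp [Var.kind], hi, him⟩
  have hu : Var.u i ≠ v := by
    rintro rfl
    exact hc ⟨by simp [Var.kind], hi, him⟩
  simp [hx, hu]

theorem differsBelow_update {m : ℕ} (hm : m + 1 ≤ n) (c : Bool) (a : Var → Bool) :
    DiffersBelow n (m + 1) (Function.update a (Var.u (m + 1)) c) ↔
      DiffersBelow n m a ∨ a (Var.x (m + 1)) ≠ c := by
  constructor
  · rintro ⟨i, hi, him, hne⟩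
    by_cases h : i = m + 1
    · subst h
      exact Or.inr (by simpa using hne)
    · exact Or.inl ⟨i, hi, by omega, by simpa [h] using hne⟩
  · rintro (⟨i, hi, him, hne⟩ | h)
    · exact ⟨i, hi, by omega, by simpa [show i ≠ m + 1 by omega] using hne⟩
    · exact ⟨m + 1, by omega, le_rfl, by simpa using h⟩

theorem essential_differsBelow {m : ℕ} (hm : m + 1 ≤ n) :
    Essential (boolFunction (DiffersBelow n (m + 1))) (Var.u (m + 1)) := by
  -- When all pairs agree, the value of `u (m + 1)` alone decides.
  refine ⟨fun _ => false, fun h => ?_⟩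
  rw [Bool.eq_iff_iff, boolFunction_eq_true, boolFunction_eq_true, differsBelow_update hm,
    differsBelow_update hm] at h
  have h0 : ¬ DiffersBelow n m fun _ => false := by
    rintro ⟨i, -, -, h⟩
    exact h rfl
  simp [h0] at h

theorem narrowOn_differsBelow_or {m : ℕ} (hm : m + 1 ≤ n) (c : Bool) :
    NarrowOn (eqOrder n) (2 ^ 2 ^ 5) fun a => DiffersBelow n m a ∨ a (Var.x (m + 1)) ≠ c := by
  have h := narrowOn_someBlock (by omega)
    (fun i b d => (i ≤ m ∧ b ≠ d) ∨ i = m + 1 ∧ b ≠ c) (n := n)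
  have he : SomeBlock n (fun i b d => (i ≤ m ∧ b ≠ d) ∨ i = m + 1 ∧ b ≠ c) =
      fun a => DiffersBelow n m a ∨ a (Var.x (m + 1)) ≠ c := by
    funext a
    refine propext ⟨?_, ?_⟩
    · rintro ⟨i, hi, h | ⟨rfl, h⟩⟩
      · exact Or.inl ⟨i, hi, h⟩
      · exact Or.inr h
    · rintro (⟨i, hi, h⟩ | h)
      · exact ⟨i, hi, Or.inl h⟩
      · exact ⟨m + 1, by omega, Or.inr ⟨rfl, h⟩⟩
  rwa [he] at h

/-- Setting `u (m + 1)` to either constant leaves `DiffersBelow n m` or one of the two literals of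
`x (m + 1)`. The literals contradict each other, so the conjunction is `DiffersBelow n m`: three new
lines per pair. -/
theorem exists_isDerivation_differsBelow {m : ℕ} (hm : m + 1 ≤ n) {L : List ((Var → Bool) → Prop)}
    (hL : IsDerivation (eqPrime n hn) (eqOrder n) (2 ^ 2 ^ 5) L)
    (hmem : DiffersBelow n (m + 1) ∈ L) :
    ∃ L', IsDerivation (eqPrime n hn) (eqOrder n) (2 ^ 2 ^ 5) L' ∧ DiffersBelow n m ∈ L' ∧
      L'.length = L.length + 3 := by
  have hred : ∀ c L', DiffersBelow n (m + 1) ∈ L' → DerivedFrom (eqPrime n hn) L'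
      fun a => DiffersBelow n m a ∨ a (Var.x (m + 1)) ≠ c := by
    refine fun c L' hmem' => Or.inr (Or.inr ⟨_, hmem', Var.u (m + 1), essential_differsBelow hm,
      isUniversal_u hn ⟨by omega, hm⟩, fun v hv hne => ?_, c, fun a =>
        (differsBelow_update hm c a).symm⟩)
    obtain ⟨h1, h2, h3⟩ := differsBelow_of_essential hv
    refine (leftOf_eqPrime hn).2 ⟨h2, ⟨by simp [Var.idx], hm⟩, ?_⟩
    cases v with
    | x i =>
      simp only [Var.idx, Var.kind] at h2 ⊢
      omega
    | u i =>
      simp only [Var.idx, Var.kind] at h3 ⊢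
      have : i ≠ m + 1 := fun h => hne (h ▸ rfl)
      omega
    | _ => simp [Var.kind] at h1
  have h1 := hL.append (narrowOn_differsBelow_or hm false) (hred false L hmem)
  have h2 := h1.append (narrowOn_differsBelow_or hm true)
    (hred true _ (List.mem_append_left _ hmem))
  refine ⟨_, h2.append (narrowOn_someBlock (by omega) _) (Or.inl ⟨_,
    List.mem_append_left _ (List.mem_append_right _ (List.mem_singleton_self _)), _,
    List.mem_append_right _ (List.mem_singleton_self _), fun a => ?_⟩),
      List.mem_append_right _ (List.mem_singleton_self _), by simp⟩
  change DiffersBelow n m a ↔ _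
  by_cases h : DiffersBelow n m a <;> simp [h]

theorem exists_obddRefutation_eqPrime : ∃ P : OBDDRefutation (eqPrime n hn),
    P.size ≤ (11 * n + 1) * (4 * n * 2 ^ 2 ^ 5 + 2) := by
  have hlen := length_matrix_eqPrime hn
  obtain ⟨L₁, h1, hmem1, hlen1⟩ := exists_isDerivation_matrix_conj (Φ := eqPrime n hn)
    (fun h => by rw [h] at hlen; simp at hlen; omega) fun A hA => narrowOn_clauses hn hA
  have he : (fun a => ∀ C ∈ (eqPrime n hn).matrix, C.Sat a) =
      ProjectedConj ∅ fun (C : {C // C ∈ (eqPrime n hn).matrix}) a => C.1.Sat a := by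
    funext a
    simp [projectedConj_empty]
  rw [he] at hmem1
  set l : List Var := (List.range' 1 n).map Var.t ++ (List.range' 1 n).map Var.e with hl
  have hmem_l : ∀ v, v ∈ l ↔ 2 ≤ v.kind ∧ 1 ≤ v.idx ∧ v.idx ≤ n := by
    intro v
    cases v <;> simp [hl, Var.kind, Var.idx] <;> omega
  obtain ⟨L₂, h2, hmem2, hlen2⟩ := h1.exists_projectedConj
    (narrowOn_projectedConj_clauses hn (List.Subset.refl _)) hmem1 l
  have he2 : (ProjectedConj {v | v ∈ l} fun (C : {C // C ∈ (eqPrime n hn).matrix}) a => C.1.Sat a) =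
      DiffersBelow n n := by
    funext a
    refine propext ⟨?_, ?_⟩
    · rintro ⟨ρ, hρ, hall⟩
      obtain ⟨i, hi, hne⟩ := exists_ne_of_matrix_sat hn fun C hC => hall ⟨C, hC⟩
      rw [hρ _ (by simp [hmem_l, Var.kind]), hρ _ (by simp [hmem_l, Var.kind])] at hne
      exact ⟨i, hi, hi.2, hne⟩
    · rintro ⟨k, hk, -, hne⟩
      classical
      refine ⟨fun v => if v ∈ l then chainWitness k a v else a v, fun v hv => if_neg hv, ?_⟩
      rintro ⟨C, hC⟩
      refine Clause.Sat.congr (fun p hp => ?_) (matrix_sat_chainWitness hn hk hne C hC)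
      have hv := (mem_vars_eqPrime hn).1 ((eqPrime n hn).closed C hC p hp)
      generalize p.1 = v at hv
      simp only [hmem_l]
      cases v <;> simp [Var.kind, chainWitness] <;> intro h <;> simp [Var.idx] at hv h <;> omega
  rw [he2] at hmem2
  have key : ∀ m ≤ n, ∃ L, IsDerivation (eqPrime n hn) (eqOrder n) (2 ^ 2 ^ 5) L ∧
      DiffersBelow n m ∈ L ∧ L.length + 3 * m = L₂.length + 3 * n := by
    intro m hm
    induction hm using Nat.decreasingInduction with
    | self => exact ⟨L₂, h2, hmem2, rfl⟩
    | of_succ m hm ih =>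
      obtain ⟨L, hL, hmem, hlenL⟩ := ih
      obtain ⟨L', hL', hmem', hlen'⟩ := exists_isDerivation_differsBelow hn hm hL hmem
      exact ⟨L', hL', hmem', by omega⟩
  obtain ⟨L, hL, hmem, hlenL⟩ := key 0 (Nat.zero_le _)
  have he3 : DiffersBelow n 0 = fun _ => False := by
    funext a
    refine propext ⟨?_, False.elim⟩
    rintro ⟨i, hi, hi0, -⟩
    omega
  have hnar := hL.narrow _ hmem
  rw [he3] at hmem hnar
  -- The contradiction is in the list but perhaps not at its end, so it is conjoined with itself.
  -- The count is at most `6n` lines for the matrix and its conjunction, `2n` projections, `3n`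
  -- reduction steps, and this one.
  obtain ⟨P, hP⟩ := (hL.append hnar (Or.inl ⟨_, hmem, _, hmem, fun a => by simp⟩)).exists_refutation
    (nodup_eqOrder n) fun v => by rw [mem_eqOrder, mem_vars_eqPrime]
  refine ⟨P, hP.trans ?_⟩
  rw [length_eqOrder]
  refine Nat.mul_le_mul_right _ ?_
  have : l.length = 2 * n := by simp [hl]; omega
  omega

end EqPrime

/-! ### The lower bound for IR-calc -/

section LowerBound

variable {n : ℕ} (hn : 2 ≤ n)

/-- Under `x i = α i` and the partial assignment `σ` of the variables `u i`, the matrix implies the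
disjunction of the literals in `S`. -/
def ImpliedUnder (α : ℕ → Bool) (σ : PartialAssignment Var) (S : Set (Lit Var)) : Prop :=
  ∀ a : Var → Bool, (∀ i, 1 ≤ i ∧ i ≤ n → a (Var.x i) = α i) →
    (∀ i b, 1 ≤ i ∧ i ≤ n → σ (Var.u i) = some b → a (Var.u i) = b) →
    (∀ C ∈ (eqPrime n hn).matrix, C.Sat a) → ∃ l ∈ S, a l.1 = l.2

/-- The annotated clause `L` contains a literal that is true under `x i = α i`, or it contains, with
a single annotation, a nonempty clause in the variables `t i` and `e i` that is implied by the matrix. -/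
def Productive (α : ℕ → Bool) (L : AnnClause Var) : Prop :=
  (∃ i σ, ((Var.x i, α i), σ) ∈ L) ∨
  ∃ (σ : PartialAssignment Var) (S : Set (Lit Var)), S.Nonempty ∧
    (∀ l ∈ S, 2 ≤ l.1.kind ∧ 1 ≤ l.1.idx ∧ l.1.idx ≤ n) ∧ (∀ l ∈ S, (l, σ) ∈ L) ∧
    ImpliedUnder hn α σ S

/-- Otherwise `u k` may be set to the opposite of `α k` without violating `σ`, and `chainWitness k`
satisfies the matrix. -/
theorem eq_of_impliedUnder_empty {α : ℕ → Bool} {σ : PartialAssignment Var}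
    (h : ImpliedUnder hn α σ ∅) {k : ℕ} (hk : 1 ≤ k ∧ k ≤ n) : σ (Var.u k) = some (α k) := by
  by_contra hne
  let a : Var → Bool
    | Var.x i => α i
    | Var.u i => if i = k then !α k else (σ (Var.u i)).getD false
    | _ => false
  obtain ⟨l, hl, -⟩ := h (chainWitness k a) (fun i _ => rfl) (fun i b hi hb => by
    change (if i = k then !α k else (σ (Var.u i)).getD false) = b
    split_ifs with hik
    · subst hik
      rw [hb] at hne
      cases b <;> cases hα : α i <;> simp_all
    · simp [hb]) (matrix_sat_chainWitness hn hk (by simp [a]))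
  exact hl

/-- All `t` and `e` are right of all `u`, so restriction acts alike on them. This is why one
annotation can serve a whole clause in `Productive`. -/
theorem restrictAnn_eqPrime {v : Var} (hv : 2 ≤ v.kind ∧ 1 ≤ v.idx ∧ v.idx ≤ n)
    (τ : PartialAssignment Var) :
    (eqPrime n hn).restrictAnn v τ = (eqPrime n hn).restrictAnn (Var.t 1) τ := by
  funext w
  have h : ∀ v : Var, 2 ≤ v.kind ∧ 1 ≤ v.idx ∧ v.idx ≤ n → ((eqPrime n hn).IsUniversal w ∧
      (eqPrime n hn).LeftOf w v ↔ (eqPrime n hn).IsUniversal w) := by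
    intro v hv
    refine and_iff_left_of_imp fun hw => ?_
    rw [isUniversal_eqPrime] at hw
    refine (leftOf_eqPrime hn).2 ⟨hw.2, hv.2, ?_⟩
    have := Nat.mul_le_mul_right n hv.1
    rw [hw.1]
    omega
  have h1 := h (Var.t 1) ⟨le_rfl, le_rfl, by simp only [Var.idx]; omega⟩
  have h2 := h v hv
  unfold PCNF.restrictAnn
  by_cases hw : (eqPrime n hn).IsUniversal w
  · rw [if_pos (h2.2 hw), if_pos (h1.2 hw)]
  · rw [if_neg (mt h2.1 hw), if_neg (mt h1.1 hw)]

theorem restrictAnn_t_u (τ : PartialAssignment Var) {i : ℕ} (hi : 1 ≤ i ∧ i ≤ n) :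
    (eqPrime n hn).restrictAnn (Var.t 1) τ (Var.u i) = τ (Var.u i) := by
  refine if_pos ⟨isUniversal_u hn hi, (leftOf_eqPrime hn).2 ⟨hi, ?_⟩⟩
  simp only [Var.idx, Var.kind]
  omega

/-- Without a true `x`-literal, `α` falsifies the `x`-part and the annotation falsifies the
`u`-part, so the matrix implies what is left. That is nonempty, as each clause contains some `t`. -/
theorem productive_of_isIRAxiom (α : ℕ → Bool) {L : AnnClause Var}
    (hL : (eqPrime n hn).IsIRAxiom L) : Productive hn α L := by
  obtain ⟨C, hC, τ, hτ, rfl⟩ := hL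
  have hr : ∀ l ∈ C, 1 ≤ l.1.idx ∧ l.1.idx ≤ n := fun l hl =>
    (mem_vars_eqPrime hn).1 ((eqPrime n hn).closed C hC l hl)
  by_cases hx : ∃ i, (Var.x i, α i) ∈ C
  · obtain ⟨i, hi⟩ := hx
    exact Or.inl ⟨i, (eqPrime n hn).restrictAnn (Var.x i) τ, hi,
      (isExistential_eqPrime hn).2 ⟨by simp [Var.kind], hr _ hi⟩, rfl⟩
  refine Or.inr ⟨(eqPrime n hn).restrictAnn (Var.t 1) τ, {l | l ∈ C ∧ 2 ≤ l.1.kind}, ?_,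
    fun l hl => ⟨hl.2, hr l hl.1⟩, fun l hl => ⟨hl.1, ?_, ?_⟩, fun a hax hau hsat => ?_⟩
  · rcases (mem_matrix_eqPrime hn).1 hC with ⟨i, -, rfl | rfl⟩ | rfl | ⟨i, -, rfl⟩ | rfl
    · exact ⟨(Var.t i, false), by simp [Var.kind]⟩
    · exact ⟨(Var.t i, false), by simp [Var.kind]⟩
    · exact ⟨(Var.t 1, true), by simp [Var.kind]⟩
    · exact ⟨(Var.t i, true), by simp [Var.kind]⟩
    · exact ⟨(Var.t n, true), by simp [Var.kind]⟩
  · exact (isExistential_eqPrime hn).2 ⟨fun h => absurd (h ▸ hl.2) (by decide), hr l hl.1⟩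
  · exact (restrictAnn_eqPrime hn ⟨hl.2, hr l hl.1⟩ τ).symm
  · obtain ⟨⟨v, b⟩, hl, hab⟩ := hsat C hC
    have hv := hr _ hl
    cases v with
    | x i =>
      rw [hax i hv] at hab
      exact absurd ⟨i, hab ▸ hl⟩ hx
    | u i =>
      have h := (hτ (Var.u i) (!b)).2 ⟨isUniversal_u hn hv, by simpa using hl⟩
      rw [← restrictAnn_t_u hn τ (i := i) hv] at h
      have := (hau i _ hv h).symm.trans hab
      simp at this
    | _ => exact ⟨_, ⟨hl, by simp [Var.kind]⟩, hab⟩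

/-- Instantiation keeps the values of `σ` and only adds more, so fewer assignments have to be
considered. -/
theorem Productive.inst {α : ℕ → Bool} {L : AnnClause Var} (hL : Productive hn α L)
    (τ : PartialAssignment Var) : Productive hn α ((eqPrime n hn).inst τ L) := by
  rcases hL with ⟨i, σ, h⟩ | ⟨σ, S, hne, hS, hmem, himp⟩
  · exact Or.inl ⟨i, _, _, h, rfl⟩
  · refine Or.inr ⟨(eqPrime n hn).restrictAnn (Var.t 1) (σ.comp τ), S, hne, hS, fun l hl =>
      ⟨_, hmem l hl, ?_⟩, fun a hax hau hsat => himp a hax (fun i b hi hb => hau i b hi ?_) hsat⟩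
    · simp only [restrictAnn_eqPrime hn (hS l hl)]
    · rw [restrictAnn_t_u hn _ hi]
      simp [PartialAssignment.comp, hb]

/-- A resolution step leads from productive clauses to a productive clause, unless its pivot is
annotated with `u i = α i` for all `i`. -/
theorem Productive.resolve {α : ℕ → Bool} {e : Var} {τ : PartialAssignment Var}
    {C₁ C₂ : AnnClause Var} (h1 : Productive hn α (insert ((e, true), τ) C₁))
    (h2 : Productive hn α (insert ((e, false), τ) C₂)) (h : ¬ Productive hn α (C₁ ∪ C₂)) {k : ℕ}
    (hk : 1 ≤ k ∧ k ≤ n) : τ (Var.u k) = some (α k) := by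
  -- A witness for a premise that avoids the pivot would be inherited by the resolvent. So a true
  -- `x`-literal must be the pivot itself, and (`hs`) a witnessing set must contain it, with
  -- annotation `τ`.
  have hx : ∀ {i σ b}, ((Var.x i, α i), σ) ∈ insert ((e, b), τ) (C₁ ∪ C₂) → Var.x i = e ∧ α i = b := by
    rintro i σ b (h' | h')
    · simp only [Prod.mk.injEq] at h'
      exact h'.1
    · exact absurd (Or.inl ⟨i, σ, h'⟩) h
  have hs : ∀ {σ : PartialAssignment Var} {S : Set (Lit Var)} {b : Bool}, S.Nonempty →
      (∀ l ∈ S, 2 ≤ l.1.kind ∧ 1 ≤ l.1.idx ∧ l.1.idx ≤ n) →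
      (∀ l ∈ S, (l, σ) ∈ insert ((e, b), τ) (C₁ ∪ C₂)) → ImpliedUnder hn α σ S →
      2 ≤ e.kind ∧ σ = τ := by
    intro σ S b hne hS hmem himp
    by_contra hc
    refine h (Or.inr ⟨σ, S, hne, hS, fun l hl => (hmem l hl).resolve_left fun he => hc ?_, himp⟩)
    rw [Prod.mk.injEq] at he
    refine ⟨?_, he.2⟩
    have := (hS l hl).1
    rwa [he.1] at this
  have hsub1 : insert ((e, true), τ) C₁ ⊆ insert ((e, true), τ) (C₁ ∪ C₂) :=
    Set.insert_subset_insert Set.subset_union_left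
  have hsub2 : insert ((e, false), τ) C₂ ⊆ insert ((e, false), τ) (C₁ ∪ C₂) :=
    Set.insert_subset_insert Set.subset_union_right
  have hkx : ∀ {i}, Var.x i = e → ¬ 2 ≤ e.kind := by
    rintro i rfl
    simp [Var.kind]
  rcases h1 with ⟨i, σ, h1⟩ | ⟨σ₁, S₁, hne1, hS1, hmem1, himp1⟩ <;>
    rcases h2 with ⟨j, σ', h2⟩ | ⟨σ₂, S₂, hne2, hS2, hmem2, himp2⟩
  · obtain ⟨he, hα⟩ := hx (hsub1 h1)
    obtain ⟨he', hα'⟩ := hx (hsub2 h2)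
    cases he.trans he'.symm
    simp [hα] at hα'
  · exact absurd (hs hne2 hS2 (fun l hl => hsub2 (hmem2 l hl)) himp2).1 (hkx (hx (hsub1 h1)).1)
  · exact absurd (hs hne1 hS1 (fun l hl => hsub1 (hmem1 l hl)) himp1).1 (hkx (hx (hsub2 h2)).1)
  · obtain ⟨-, rfl⟩ := hs hne1 hS1 (fun l hl => hsub1 (hmem1 l hl)) himp1
    obtain ⟨-, rfl⟩ := hs hne2 hS2 (fun l hl => hsub2 (hmem2 l hl)) himp2
    -- The witnessing sets themselves can be resolved. A nonempty result would witness productivity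
    -- of the resolvent, so it is empty and the annotation must be all of `α`.
    have himp : ImpliedUnder hn α σ₂ (S₁ \ {(e, true)} ∪ S₂ \ {(e, false)}) := by
      intro a hax hau hsat
      obtain ⟨l, hl, hal⟩ := himp1 a hax hau hsat
      obtain ⟨l', hl', hal'⟩ := himp2 a hax hau hsat
      by_cases h1 : l = (e, true)
      · by_cases h2 : l' = (e, false)
        · subst h1 h2
          simp [hal] at hal'
        · exact ⟨l', Or.inr ⟨hl', h2⟩, hal'⟩
      · exact ⟨l, Or.inl ⟨hl, h1⟩, hal⟩
    rcases Set.eq_empty_or_nonempty (S₁ \ {(e, true)} ∪ S₂ \ {(e, false)}) with hS | hS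
    · rw [hS] at himp
      exact eq_of_impliedUnder_empty hn himp hk
    · refine absurd (Or.inr ⟨σ₂, _, hS, ?_, ?_, himp⟩) h
      · rintro l (hl | hl)
        · exact hS1 l hl.1
        · exact hS2 l hl.1
      · rintro l (hl | hl)
        · exact Or.inl ((hmem1 l hl.1).resolve_left fun he => hl.2 (Prod.ext_iff.1 he).1)
        · exact Or.inr ((hmem2 l hl.1).resolve_left fun he => hl.2 (Prod.ext_iff.1 he).1)

theorem not_productive_empty (α : ℕ → Bool) : ¬ Productive hn α ∅ := by
  rintro (⟨i, σ, h⟩ | ⟨σ, S, ⟨l, hl⟩, -, h, -⟩)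
  · exact h
  · exact h l hl

theorem two_pow_le_size_irRefutation (R : IRRefutation (eqPrime n hn)) : 2 ^ n ≤ R.size := by
  -- The annotation is chosen before `α`: it depends only on the line. Hence a line can be the first
  -- unproductive one for only one `α` on `1, …, n`.
  have hpivot : ∀ i, ∃ τ : PartialAssignment Var, ∀ α : ℕ → Bool, ¬ Productive hn α (R.line i) →
      (∀ j < i, Productive hn α (R.line j)) → ∀ k, 1 ≤ k ∧ k ≤ n → τ (Var.u k) = some (α k) := by
    intro i
    rcases R.derived i with h | ⟨j, j', hj, hj', e, τ, C₁, C₂, h1, h2, h3⟩ | ⟨j, hj, τ, -, h⟩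
    · exact ⟨fun _ => none, fun α hα => absurd (productive_of_isIRAxiom hn α h) hα⟩
    · refine ⟨τ, fun α hα hprod k hk => ?_⟩
      rw [h3] at hα
      exact Productive.resolve hn (h1 ▸ hprod j hj) (h2 ▸ hprod j' hj') hα hk
    · exact ⟨fun _ => none, fun α hα hprod => absurd (h ▸ (hprod j hj).inst hn τ) hα⟩
  choose pivot hpivot using hpivot
  have hfirst : ∀ α : ℕ → Bool, ∃ i, ∀ k, 1 ≤ k ∧ k ≤ n → pivot i (Var.u k) = some (α k) := by
    intro α
    obtain ⟨i, hi, hmin⟩ := WellFounded.has_min (wellFounded_lt (α := Fin (R.last + 1)))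
      {i | ¬ Productive hn α (R.line i)}
      ⟨Fin.last R.last, by simpa [R.final] using not_productive_empty hn α⟩
    exact ⟨i, hpivot i α hi fun j hj => not_not.1 fun h => hmin j h hj⟩
  choose first hfirst using hfirst
  have hinj : Function.Injective fun c : Fin n → Bool =>
      first fun k => if h : k - 1 < n then c ⟨k - 1, h⟩ else false := by
    intro c c' h
    funext k
    have h1 := hfirst (fun k => if h : k - 1 < n then c ⟨k - 1, h⟩ else false) (k + 1) (by omega)
    have h2 := hfirst (fun k => if h : k - 1 < n then c' ⟨k - 1, h⟩ else false) (k + 1) (by omega)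
    simp only at h
    rw [h, h2] at h1
    simpa using h1.symm
  simpa [IRRefutation.size] using Fintype.card_le_of_injective _ hinj

end LowerBound

/-! ### Polynomial versus exponential growth, and the conclusion -/

theorem exists_eval_lt_two_pow (p : Polynomial ℕ) : ∃ n, 2 ≤ n ∧ p.eval n < 2 ^ n := by
  have h : Filter.Tendsto (fun n : ℕ => ∑ i ∈ Finset.range (p.natDegree + 1),
      (p.coeff i : ℝ) * ((n : ℝ) ^ i / 2 ^ n)) Filter.atTop (nhds 0) := by
    have := tendsto_finsetSum (Finset.range (p.natDegree + 1)) fun i _ =>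
      (tendsto_pow_const_div_const_pow_of_one_lt i (one_lt_two (α := ℝ))).const_mul (p.coeff i : ℝ)
    simpa using this
  obtain ⟨n, h1, h2⟩ := ((h.eventually (gt_mem_nhds one_pos)).and (Filter.eventually_ge_atTop 2)).exists
  refine ⟨n, h2, ?_⟩
  have h3 : ((p.eval n : ℕ) : ℝ) / 2 ^ n < 1 := by
    refine lt_of_eq_of_lt ?_ h1
    rw [Polynomial.eval_eq_sum_range]
    push_cast
    rw [Finset.sum_div]
    exact Finset.sum_congr rfl fun i _ => mul_div_assoc _ _ _
  rw [div_lt_one (by positivity)] at h3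
  exact_mod_cast h3

theorem Polynomial.eval_le_eval_of_le (p : Polynomial ℕ) {a b : ℕ} (h : a ≤ b) :
    p.eval a ≤ p.eval b := by
  rw [Polynomial.eval_eq_sum_range, Polynomial.eval_eq_sum_range]
  gcongr

theorem mainTheorem4 :
    -- The formula is false, `u_i = x_i` is a universal winning strategy, and it is the only one, as a
    -- function from assignments of the existential to assignments of the universal variables.
    (∀ (n : ℕ) (hn : 2 ≤ n),
      (eqPrime n hn).IsFalse ∧
      (eqPrime n hn).IsUniversalWinning eqStrategy ∧
      (∀ (τ : Var → Bool), ∀ i ∈ Finset.Icc 1 n,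
        (eqPrime n hn).play eqStrategy τ (Var.u i) = τ (Var.x i)) ∧
      (∀ f, (eqPrime n hn).IsUniversalWinning f → ∀ (τ : Var → Bool), ∀ i ∈ Finset.Icc 1 n,
        (eqPrime n hn).play f τ (Var.u i) = τ (Var.x i))) ∧
    -- bounded pathwidth
    (∃ k : ℕ, ∀ (n : ℕ) (hn : 2 ≤ n), (eqPrime n hn).pathwidth ≤ k) ∧
    -- polynomial-size refutations in OBDD(∧, ∃, ∀)
    (∃ p : Polynomial ℕ, ∀ (n : ℕ) (hn : 2 ≤ n),
      ∃ P : OBDDRefutation (eqPrime n hn), P.size ≤ p.eval n) ∧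
    -- exponential lower bound for IR-calc
    (∃ c : ℝ, 0 < c ∧ ∀ (n : ℕ) (hn : 2 ≤ n) (R : IRRefutation (eqPrime n hn)),
      c * 2 ^ n ≤ (R.size : ℝ)) ∧
    -- IR-calc does not p-simulate OBDD(∧, ∃, ∀)
    (¬ ∃ p : Polynomial ℕ, ∀ (Φ : PCNF Var) (P : OBDDRefutation Φ),
      ∃ R : IRRefutation Φ, R.size ≤ p.eval P.size) := by
  have hupper : ∃ p : Polynomial ℕ, ∀ (n : ℕ) (hn : 2 ≤ n),
      ∃ P : OBDDRefutation (eqPrime n hn), P.size ≤ p.eval n := by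
    refine ⟨(11 * Polynomial.X + 1) * (4 * Polynomial.X * 2 ^ 2 ^ 5 + 2), fun n hn => ?_⟩
    obtain ⟨P, hP⟩ := exists_obddRefutation_eqPrime hn
    refine ⟨P, hP.trans_eq ?_⟩
    simp only [Polynomial.eval_mul, Polynomial.eval_add, Polynomial.eval_pow, Polynomial.eval_X,
      Polynomial.eval_ofNat, Polynomial.eval_one]
  refine ⟨fun n hn => ⟨⟨_, isUniversalWinning_eqStrategy hn⟩, isUniversalWinning_eqStrategy hn,
    fun τ i hi => play_eqStrategy hn τ (Finset.mem_Icc.1 hi), fun f hf τ i hi =>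
      play_eq_of_isUniversalWinning hn hf τ (Finset.mem_Icc.1 hi)⟩,
    ⟨4, fun n hn => pathwidth_eqPrime_le hn⟩, hupper, ⟨1, one_pos, fun n hn R => ?_⟩, ?_⟩
  · rw [one_mul]
    exact_mod_cast two_pow_le_size_irRefutation hn R
  · rintro ⟨p, hp⟩
    obtain ⟨q, hq⟩ := hupper
    -- A simulation would give IR-calc refutations of size at most `p (q n)`, using that polynomials
    -- over `ℕ` are monotone.
    obtain ⟨n, hn, hlt⟩ := exists_eval_lt_two_pow (p.comp q)
    obtain ⟨P, hP⟩ := hq n hn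
    obtain ⟨R, hR⟩ := hp _ P
    refine absurd (two_pow_le_size_irRefutation hn R) (not_le.2 (lt_of_le_of_lt ?_ hlt))
    rw [Polynomial.eval_comp]
    exact hR.trans (p.eval_le_eval_of_le hP)
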